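/- **Split trees.** Let $b\ge 1$ and let $s,s_0,s_1\ge 0$ be integers with $0\le b s_1\le s+1-s_0$ and $(s,s_0)\neq(0,0)$. Let $\mathcal V=(V_1,\dots,V_b)$ be a random vector with $V_i\ge 0$, $\sum_i V_i=1$ almost surely and $\mathbf P(\exists i: V_i=1)<1$. In the infinite rooted $b$-ary tree give every node $u$ an independent copy $\mathcal V_u$ of $\mathcal V$. For $n\ge 0$ the split tree $T^n$ is described by the numbers $n_u$ of items in the subtrees rooted at the nodes $u$: the root $\varnothing$ has $n_\varnothing=n$; if $n_u>s$, then, given $n_u$ and $\mathcal V_u=(V_1,\dots,V_b)$, and independently of what happens at the nodes that are not descendants of $u$, the cardinalities of the $b$ children of $u$ are distributed as $$\mathrm{Mult}(n_u-s_0-bs_1;\,V_1,\dots,V_b)+(s_1,\dots,s_1),$$ and $s_0$ items stay at $u$; if $n_u\le s$, then all $n_u$ items stay at $u$ and the children of $u$ have cardinality $0$. Let $\Psi(T^n)$ be the total path length, that is, the sum of the depths of the nodes at which the $n$ items are stored. Let $V$ be a uniformly random component of $\mathcal V$, let $\mu=b\,\mathbf E[-V\ln V]$ (with $0\ln 0=0$),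 and let $$d=\sup\{a\ge 0:\ \mathbf P(\ln V\in a\mathbb Z)=1\},$$ where the value $V=0$ (that is, $\ln V=-\infty$) imposes no constraint and $d=0$ if there is no such $a$. Call $\ln V$ lattice if there is $a\in\mathbb R$ with $\ln V\in a\mathbb Z$ almost surely (in the same sense). **Theorem.** The expectation $\mathbf E[\Psi(T^n)]$ is finite for every $n$, and there is a continuous function $\varpi:\mathbb R\to\mathbb R$, periodic with period $d$, such that, as $n\to\infty$, $$\mathbf E[\Psi(T^n)]=\mu^{-1}n\ln n+n\,\varpi(\ln n)+o(n).$$ If $d=0$, then $\varpi$ is constant. In particular, if $\ln V$ is not lattice, then $d=0$ and $\varpi$ is constant. -/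

import Mathlib

open MeasureTheory Filter Asymptotics Set
open scoped ENNReal unitInterval

namespace SplitTree

/-- Nodes of the infinite rooted `b`-ary tree, as finite words over `Fin b`. Words are written with
the last letter first: the root is `[]`, the `i`-th child of `u` is `i :: u`, and the depth of `u`
is `u.length`. -/
abbrev Node (b : ℕ) : Type := List (Fin b)

/-- The randomness attached to one node: its split vector `(V_1, …, V_b)` and a sequence of
numbers in `[0, 1]` by which the items passing through the node choose a child. -/
abbrev NodeData (b : ℕ) : Type := (Fin b → ℝ) × (ℕ → I)

/-- The number `x` selects child `i` under the split vector `v`: it lies in the `i`-th of the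
consecutive intervals of lengths `v 0, v 1, …`. For `x` uniform on `[0, 1]` and `v` a probability
vector, child `i` is selected with probability `v i`. -/
def Selects {b : ℕ} (v : Fin b → ℝ) (x : ℝ) (i : Fin b) : Prop :=
  ∑ k ∈ Finset.Iio i, v k ≤ x ∧ x < ∑ k ∈ Finset.Iic i, v k

open Classical in
/-- The number of those of the first `m` items that choose child `i`. For i.i.d. uniform choices,
the vector `(count D m i)_i` has, given the split vector `D.1`, the multinomial distribution
`Mult(m, D.1)`. -/
noncomputable def count {b : ℕ} (D : NodeData b) (m : ℕ) (i : Fin b) : ℕ :=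
  ((Finset.range m).filter fun j => Selects D.1 (D.2 j) i).card

/-- The cardinalities `n_u` of the subtrees of the split tree with `n` items and parameters
`s, s₀, s₁`. A node with more than `s` items keeps `s₀` of them, gives `s₁` to each of its `b`
children and lets each of the others choose a child; below a node with at most `s` items nothing is
stored. -/
noncomputable def size {b : ℕ} (s s₀ s₁ n : ℕ) (ω : Node b → NodeData b) : Node b → ℕ
  | [] => n
  | i :: u =>
    if s < size s s₀ s₁ n ω u then
      s₁ + count (ω u) (size s s₀ s₁ n ω u - s₀ - b * s₁) i
    else 0

/-- The number of items stored at the node `u` itself: `s₀` at an internal node (more than `s` items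
in its subtree), and all the items of its subtree at any other node. -/
noncomputable def stored {b : ℕ} (s s₀ s₁ n : ℕ) (ω : Node b → NodeData b) (u : Node b) : ℕ :=
  if s < size s s₀ s₁ n ω u then s₀ else size s s₀ s₁ n ω u

/-- The total path length `Ψ(T^n)`: the sum of the depths of all items. -/
noncomputable def pathLength {b : ℕ} (s s₀ s₁ n : ℕ) (ω : Node b → NodeData b) : ℝ≥0∞ :=
  ∑' u : Node b, (u.length : ℝ≥0∞) * (stored s s₀ s₁ n ω u : ℝ≥0∞)

/-- The law of the randomness: the nodes carry independent copies of a pair made of a split vector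
with law `ν` and an independent sequence of i.i.d. uniform variables on `[0, 1]`. -/
noncomputable def law {b : ℕ} (ν : Measure (Fin b → ℝ)) [IsProbabilityMeasure ν] :
    Measure (Node b → NodeData b) :=
  Measure.infinitePi fun _ : Node b =>
    ν.prod (Measure.infinitePi fun _ : ℕ => (volume : Measure I))

/-- The expected total path length `E[Ψ(T^n)]`, possibly infinite a priori. -/
noncomputable def expectedPathLength {b : ℕ} (ν : Measure (Fin b → ℝ)) [IsProbabilityMeasure ν]
    (s s₀ s₁ n : ℕ) : ℝ≥0∞ :=
  ∫⁻ ω, pathLength s s₀ s₁ n ω ∂law ν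

/-- The law of `V`, a uniformly random component of a split vector with law `ν`. -/
noncomputable def componentLaw {b : ℕ} (ν : Measure (Fin b → ℝ)) : Measure ℝ :=
  (b : ℝ≥0∞)⁻¹ • ∑ i, ν.map fun v => v i

/-- The constant `μ = b E[-V ln V]` (with `0 ln 0 = 0`). -/
noncomputable def entropyConst {b : ℕ} (ν : Measure (Fin b → ℝ)) : ℝ :=
  (b : ℝ) * ∫ x, -(x * Real.log x) ∂componentLaw ν

/-- Almost surely `ln V ∈ a ℤ`. The value `V = 0`, for which `ln V = -∞`, imposes no constraint. -/
def LogInMultiples {b : ℕ} (ν : Measure (Fin b → ℝ)) (a : ℝ) : Prop :=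
  ∀ᵐ x ∂componentLaw ν, 0 < x → ∃ k : ℤ, Real.log x = k * a

/-- `ln V` is lattice. -/
def IsLattice {b : ℕ} (ν : Measure (Fin b → ℝ)) : Prop :=
  ∃ a : ℝ, LogInMultiples ν a

/-- The span `d = sup {a ≥ 0 : P(ln V ∈ a ℤ) = 1}`, with `d = 0` if there is no such `a`. -/
noncomputable def span {b : ℕ} (ν : Measure (Fin b → ℝ)) : ℝ :=
  sSup {a : ℝ | 0 ≤ a ∧ LogInMultiples ν a}

end SplitTree

/-!
Write `f n = E Ψ(T^n)`. Counting, for each node other than the root, the items in its subtree gives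
`f n = (n - s₀) + ∑ i, E f(N_i)` for `n > s`, where `N_i = s₁ + Bin(n - s₀ - b s₁, V_i)` is the
cardinality of the `i`-th child of the root. Finiteness comes first, in extended nonnegative
arithmetic (`Admissible.expectedPathLength_ne_top`): children are never larger than their parent, and
they are strictly smaller with positive probability.

The increments `f (n + 1) - f n` satisfy the analogous recursion along a size-biased choice of
children, because adding one item changes cardinalities along a single path only. A maximum principle
bounds them by `n^(1/4) + O(1)` (`Admissible.exists_pathLengthIncrement_le`). As `N_i` is within
`O(√n)` of `n V_i` in mean, the linear interpolation of `f` satisfies the recursion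
`f t = t + ∑ i, E f(t V_i)` up to `O(t^(3/4))` (`Admissible.exists_interpolation_error`). Hence
`H(x) = exp(-x) f(exp x) - x⁺ / μ` solves a renewal equation `H(x) = E H(x - X) + r(x)` with a
continuous source `r` that decays exponentially, `X` being minus the logarithm of the size-biased
component of the split vector, whose mean is `μ`.

The renewal theorem needed here (`IsRenewalSolution.exists_periodic_limit`) has an elementary proof.
Nonnegative subsolutions of the equation with exponentially decaying source are bounded linearly by
the source (`exists_bound_of_subsolution`); thus `H` is bounded and uniformly continuous. For `h` in
the support of the law of `X`, the increments `H(x + h) - H(x)` tend to zero: otherwise they would be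
bounded below along arbitrarily long arithmetic progressions of step `h`. Applied to the positive
parts of `a - H` and `a + H`, the bound for subsolutions then shows that `H` converges along
translates of the closed group generated by the support. That group is either `ℝ`, and the limit is
constant, or it is generated by the span `d` (`Admissible.dense_or_span_mem`).
-/

/-! ### A bound for subsolutions of the renewal equation -/

namespace SplitTree

open Topology

theorem integrable_comp_sub_of_bounded {P : Measure ℝ} [IsFiniteMeasure P]
    (hP0 : ∀ᵐ y ∂P, 0 ≤ y) {g : ℝ → ℝ} (hg : Measurable g) {x M : ℝ} (hM : ∀ z ≤ x, |g z| ≤ M) :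
    Integrable (fun y => g (x - y)) P := by
  refine Integrable.of_bound (C := M)
    (hg.comp (measurable_const.sub measurable_id)).aestronglyMeasurable ?_
  filter_upwards [hP0] with y hy
  exact hM _ (by linarith)

theorem exists_pos_measure_Ici {P : Measure ℝ} (hP : 0 < P (Ioi 0)) : ∃ η > 0, 0 < P (Ici η) := by
  by_contra! h
  have : P (⋃ n : ℕ, Ici (1 / ((n : ℝ) + 1))) = 0 :=
    measure_iUnion_null fun n => le_antisymm (h _ (by positivity)) zero_le
  refine hP.ne' (measure_mono_null (fun x (hx : 0 < x) => ?_) this)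
  obtain ⟨n, hn⟩ := exists_nat_one_div_lt hx
  exact mem_iUnion.2 ⟨n, hn.le⟩

/-- Nonnegative subsolutions of the renewal equation that start at `t` and whose source decays
exponentially are bounded by a constant multiple of the size of the source. The supremum of `g` over
`(-∞, t + k η)` grows with `k` by at most a geometric sequence, because a step exceeds `η` with
positive probability. -/
theorem exists_bound_of_subsolution {P : Measure ℝ} [IsProbabilityMeasure P]
    (hP0 : ∀ᵐ y ∂P, 0 ≤ y) (hP : 0 < P (Ioi 0)) {c : ℝ} (hc : 0 < c) :
    ∃ K : ℝ, 0 ≤ K ∧ ∀ (g : ℝ → ℝ) (t C : ℝ), Measurable g → (∀ x, 0 ≤ g x) → (∀ x < t, g x = 0) →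
      (∀ T, ∃ M, ∀ x ≤ T, g x ≤ M) → 0 ≤ C →
      (∀ x, t ≤ x → g x ≤ ∫ y, g (x - y) ∂P + C * Real.exp (-c * (x - t))) →
      ∀ x, g x ≤ K * C := by
  obtain ⟨η, hη, hpη⟩ := exists_pos_measure_Ici hP
  set p := P.real (Ici η) with hp
  have hp0 : 0 < p := ENNReal.toReal_pos hpη.ne' (measure_ne_top _ _)
  have hp1 : p ≤ 1 := measureReal_le_one
  set ρ := Real.exp (-c * η) with hρ
  have hρ0 : 0 < ρ := Real.exp_pos _
  have hρ1 : ρ < 1 := by rw [hρ, Real.exp_lt_one_iff]; nlinarith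
  refine ⟨p⁻¹ * (1 - ρ)⁻¹, by have : 0 < 1 - ρ := by linarith
                              positivity, ?_⟩
  intro g t C hg hg0 hgt hbdd hC hsub x
  have key : ∀ k : ℕ, ∀ x < t + k * η, g x ≤ C / p * ∑ j ∈ Finset.range k, ρ ^ j := by
    intro k
    induction k with
    | zero => intro x hx; simp [hgt x (by simpa using hx)]
    | succ k ih =>
      set B := C / p * ∑ j ∈ Finset.range k, ρ ^ j with hB
      have hB1 : C / p * ∑ j ∈ Finset.range (k + 1), ρ ^ j = B + C * ρ ^ k / p := by
        rw [Finset.sum_range_succ, hB]; ring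
      rw [hB1]
      set τ := t + (k + 1 : ℕ) * η with hτ
      have hτk : t + k * η < τ := by rw [hτ]; push_cast; linarith
      obtain ⟨M₀, hM₀⟩ := hbdd τ
      set S := g '' Iio τ
      have hSb : BddAbove S := ⟨M₀, by rintro _ ⟨z, hz, rfl⟩; exact hM₀ z (le_of_lt hz)⟩
      have hSn : S.Nonempty := ⟨_, τ - 1, by simp, rfl⟩
      set M := sSup S
      have hgM : ∀ z < τ, g z ≤ M := fun z hz => le_csSup hSb ⟨z, hz, rfl⟩
      have hB0 : 0 ≤ B := by positivity
      -- A step of length at least `η` leads back to the region bounded by `B`.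
      have hbound : ∀ z < τ, g z ≤ max B (C * ρ ^ k + (1 - p) * M + p * B) := by
        intro z hz
        rcases lt_or_ge z (t + k * η) with h | h
        · exact (ih z h).trans (le_max_left _ _)
        · refine le_trans ?_ (le_max_right _ _)
          have hzt : t ≤ z := le_trans (by have : 0 ≤ (k : ℝ) * η := by positivity
                                           linarith) h
          have h1 : ∫ y, g (z - y) ∂P ≤ (1 - p) * M + p * B := by
            have hi : Integrable (fun y => g (z - y)) P :=
              integrable_comp_sub_of_bounded hP0 hg (M := M) fun w hw => by
                rw [abs_of_nonneg (hg0 w)]; exact hgM w (hw.trans_lt hz)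
            have hi2 : Integrable (fun y => M + (Ici η).indicator (fun _ => B - M) y) P :=
              (integrable_const _).add ((integrable_const _).indicator measurableSet_Ici)
            calc ∫ y, g (z - y) ∂P ≤ ∫ y, (M + (Ici η).indicator (fun _ => B - M) y) ∂P := by
                  refine integral_mono_ae hi hi2 ?_
                  filter_upwards [hP0] with y hy
                  by_cases hyη : η ≤ y
                  · simp only [indicator, mem_Ici, hyη, if_true]
                    have := ih (z - y) (by rw [hτ] at hz; push_cast at hz; linarith)
                    linarith
                  · simp only [indicator, mem_Ici, hyη, if_false]
                    have := hgM (z - y) (by linarith)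
                    linarith
              _ = (1 - p) * M + p * B := by
                  rw [integral_add (integrable_const _)
                    ((integrable_const _).indicator measurableSet_Ici),
                    integral_indicator measurableSet_Ici]
                  simp only [integral_const, smul_eq_mul, measureReal_restrict_apply_univ,
                    probReal_univ]
                  rw [← hp]; ring
          have h2 : C * Real.exp (-c * (z - t)) ≤ C * ρ ^ k := by
            rw [hρ, ← Real.exp_nat_mul]
            refine mul_le_mul_of_nonneg_left (Real.exp_le_exp.2 ?_) hC
            have := mul_le_mul_of_nonneg_left h hc.le
            linarith
          have := hsub z hzt
          linarith
      have hMB : M ≤ B + C * ρ ^ k / p := by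
        have hle : M ≤ max B (C * ρ ^ k + (1 - p) * M + p * B) :=
          csSup_le hSn (by rintro _ ⟨z, hz, rfl⟩; exact hbound z hz)
        have hq : 0 ≤ C * ρ ^ k / p := by positivity
        rcases le_max_iff.1 hle with h | h
        · linarith
        · have : p * (M - B) ≤ C * ρ ^ k := by linarith
          have : M - B ≤ C * ρ ^ k / p := by rw [le_div_iff₀ hp0]; linarith
          linarith
      exact fun z hz => (hgM z hz).trans hMB
  obtain ⟨k, hk⟩ := exists_nat_gt ((x - t) / η)
  rw [div_lt_iff₀ hη] at hk
  refine (key k x (by linarith)).trans ?_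
  have hgeo : ∑ j ∈ Finset.range k, ρ ^ j ≤ (1 - ρ)⁻¹ := by
    rw [← tsum_geometric_of_lt_one hρ0.le hρ1]
    exact (summable_geometric_of_lt_one hρ0.le hρ1).sum_le_tsum _ fun _ _ => by positivity
  calc C / p * ∑ j ∈ Finset.range k, ρ ^ j ≤ C / p * (1 - ρ)⁻¹ := by gcongr
    _ = p⁻¹ * (1 - ρ)⁻¹ * C := by ring

/-- `H` is a continuous solution of the renewal equation `H(x) = E H(x - X) + r(x)`, `X` of law `P`,
that vanishes on the negative half-line and whose source is bounded by `C exp(-c x)`. -/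
structure IsRenewalSolution (P : Measure ℝ) (c C : ℝ) (H r : ℝ → ℝ) : Prop where
  continuous : Continuous H
  zero : ∀ x ≤ 0, H x = 0
  continuous_source : Continuous r
  eq : ∀ x, H x = ∫ y, H (x - y) ∂P + r x
  decay : ∀ x, |r x| ≤ C * Real.exp (-c * x)

namespace IsRenewalSolution

variable {P : Measure ℝ} {c C : ℝ} {H r : ℝ → ℝ}

theorem neg (h : IsRenewalSolution P c C H r) :
    IsRenewalSolution P c C (fun x => -H x) (fun x => -r x) where
  continuous := h.continuous.neg
  zero x hx := by simp [h.zero x hx]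
  continuous_source := h.continuous_source.neg
  eq x := by rw [integral_neg]; linarith [h.eq x]
  decay x := by simpa using h.decay x

theorem exists_bound_Iic (h : IsRenewalSolution P c C H r) (T : ℝ) : ∃ M, ∀ x ≤ T, |H x| ≤ M := by
  obtain ⟨M, hM⟩ := (isCompact_Icc (a := (0 : ℝ)) (b := T)).exists_bound_of_continuousOn
    h.continuous.continuousOn
  refine ⟨max M 0, fun x hx => ?_⟩
  rcases le_total x 0 with h0 | h0
  · simp [h.zero x h0]
  · exact (hM x ⟨h0, hx⟩).trans (le_max_left _ _)

theorem integrable [IsProbabilityMeasure P] (h : IsRenewalSolution P c C H r)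
    (hP0 : ∀ᵐ y ∂P, 0 ≤ y) (x : ℝ) : Integrable (fun y => H (x - y)) P := by
  obtain ⟨M, hM⟩ := h.exists_bound_Iic x
  exact integrable_comp_sub_of_bounded hP0 h.continuous.measurable hM

theorem const_nonneg (h : IsRenewalSolution P c C H r) : 0 ≤ C := by
  have := (abs_nonneg _).trans (h.decay 0)
  simpa using this

theorem source_zero (h : IsRenewalSolution P c C H r) (hP0 : ∀ᵐ y ∂P, 0 ≤ y) {x : ℝ} (hx : x ≤ 0) :
    r x = 0 := by
  have h1 := h.eq x
  have h2 : ∫ y, H (x - y) ∂P = 0 := by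
    rw [integral_congr_ae (g := fun _ => (0 : ℝ)) (by
      filter_upwards [hP0] with y hy; exact h.zero _ (by linarith))]
    simp
  rw [h.zero x hx, h2] at h1
  linarith

theorem bounded [IsProbabilityMeasure P] (h : IsRenewalSolution P c C H r)
    (hP0 : ∀ᵐ y ∂P, 0 ≤ y) (hP : 0 < P (Ioi 0)) (hc : 0 < c) : ∃ M, ∀ x, |H x| ≤ M := by
  obtain ⟨K, -, hK⟩ := exists_bound_of_subsolution hP0 hP hc
  refine ⟨K * C, hK (fun x => |H x|) 0 C h.continuous.abs.measurable (fun x => abs_nonneg _)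
    (fun x hx => by simp [h.zero x hx.le]) h.exists_bound_Iic h.const_nonneg fun x _ => ?_⟩
  have h1 : |H x| ≤ |∫ y, H (x - y) ∂P| + |r x| := by
    rw [h.eq x]; exact abs_add_le _ _
  have h2 := abs_integral_le_integral_abs (f := fun y => H (x - y)) (μ := P)
  have h3 := h.decay x
  simp only [sub_zero]
  linarith

theorem tendsto_source (h : IsRenewalSolution P c C H r) (hc : 0 < c) : Tendsto r atTop (𝓝 0) := by
  refine squeeze_zero_norm (a := fun x => C * Real.exp (-c * x)) h.decay ?_
  have h1 : Tendsto (fun x : ℝ => -c * x) atTop atBot :=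
    tendsto_id.const_mul_atTop_of_neg (by linarith)
  simpa using (Real.tendsto_exp_atBot.comp h1).const_mul C

theorem uniformContinuous_source (h : IsRenewalSolution P c C H r) (hP0 : ∀ᵐ y ∂P, 0 ≤ y)
    (hc : 0 < c) : UniformContinuous r := by
  refine h.continuous_source.uniformContinuous_of_tendsto_cocompact (x := 0) ?_
  rw [cocompact_eq_atBot_atTop]
  refine Tendsto.sup ?_ (h.tendsto_source hc)
  refine tendsto_const_nhds.congr' ?_
  filter_upwards [eventually_le_atBot 0] with x hx
  exact (h.source_zero hP0 hx).symm

/-- The increments `H(x + h) - H(x)` solve the renewal equation with source `r(x + h) - r(x)`, which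
is both uniformly small and exponentially decaying, hence bounded by a small multiple of
`exp(-c x / 2)`. -/
theorem uniformContinuous [IsProbabilityMeasure P] (h : IsRenewalSolution P c C H r)
    (hP0 : ∀ᵐ y ∂P, 0 ≤ y) (hP : 0 < P (Ioi 0)) (hc : 0 < c) : UniformContinuous H := by
  obtain ⟨K, hK0, hK⟩ := exists_bound_of_subsolution hP0 hP (half_pos hc)
  have hC := h.const_nonneg
  rw [Metric.uniformContinuous_iff]
  intro ε hε
  set E := Real.exp (c / 2) with hE
  have hE0 : 0 < E := Real.exp_pos _
  obtain ⟨ω, hω, hωε⟩ : ∃ ω > 0, K * (Real.sqrt (2 * C * ω) * E) < ε := by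
    have : Tendsto (fun ω : ℝ => K * (Real.sqrt (2 * C * ω) * E)) (𝓝[>] 0) (𝓝 0) := by
      have h1 : Continuous fun ω : ℝ => K * (Real.sqrt (2 * C * ω) * E) := by fun_prop
      simpa using (h1.tendsto 0).mono_left nhdsWithin_le_nhds
    obtain ⟨ω, h1, h2⟩ := ((this.eventually (gt_mem_nhds hε)).and self_mem_nhdsWithin).exists
    exact ⟨ω, h2, h1⟩
  obtain ⟨δ, hδ, hδω⟩ := Metric.uniformContinuous_iff.1 (h.uniformContinuous_source hP0 hc) ω hω
  have main : ∀ u, 0 ≤ u → u ≤ 1 → u < δ → ∀ x, |H (x + u) - H x| < ε := by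
    intro u hu0 hu1 huδ x
    refine lt_of_le_of_lt (hK (fun x => |H (x + u) - H x|) (-1) (Real.sqrt (2 * C * ω) * E) ?_
      (fun x => abs_nonneg _) ?_ ?_ (by positivity) ?_ x) hωε
    · have := h.continuous
      exact Continuous.measurable (by fun_prop)
    · intro x hx
      simp [h.zero x (by linarith), h.zero (x + u) (by linarith)]
    · intro T
      obtain ⟨M, hM⟩ := h.exists_bound_Iic (T + 1)
      refine ⟨M + M, fun x hx => (abs_sub _ _).trans (add_le_add (hM _ (by linarith))
        (hM _ (by linarith)))⟩
    · intro x hx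
      have h1 : H (x + u) - H x = ∫ y, (H (x - y + u) - H (x - y)) ∂P + (r (x + u) - r x) := by
        have h2 : ∀ y, x - y + u = x + u - y := fun y => by ring
        simp only [h2]
        rw [integral_sub (h.integrable hP0 _) (h.integrable hP0 _)]
        linarith [h.eq x, h.eq (x + u)]
      have h2 := abs_integral_le_integral_abs (f := fun y => H (x - y + u) - H (x - y)) (μ := P)
      have h3 : |r (x + u) - r x| ≤ Real.sqrt (2 * C * ω) * E * Real.exp (-(c / 2) * (x - -1)) := by
        have ha : |r (x + u) - r x| ≤ ω := by
          have := hδω (a := x + u) (b := x) (by simpa [Real.dist_eq, abs_of_nonneg hu0] using huδ)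
          exact this.le
        have hb : |r (x + u) - r x| ≤ 2 * C * Real.exp (-c * x) := by
          have h4 : C * Real.exp (-c * (x + u)) ≤ C * Real.exp (-c * x) := by
            refine mul_le_mul_of_nonneg_left (Real.exp_le_exp.2 ?_) hC
            have := mul_nonneg hc.le hu0
            linarith
          linarith [abs_sub (r (x + u)) (r x), h.decay x, h.decay (x + u)]
        -- `min a b ≤ √(a b)` trades half of the decay rate for smallness.
        have hab : |r (x + u) - r x| ≤ Real.sqrt (ω * (2 * C * Real.exp (-c * x))) := by
          apply Real.le_sqrt_of_sq_le
          rw [sq]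
          exact mul_le_mul ha hb (abs_nonneg _) hω.le
        refine hab.trans (le_of_eq ?_)
        have e1 : ω * (2 * C * Real.exp (-c * x)) = (2 * C * ω) * Real.exp (-c * x) := by ring
        have e2 : Real.exp (-c * x) = (Real.exp (-c * x / 2)) ^ 2 := by
          rw [← Real.exp_nat_mul]; congr 1; push_cast; ring
        have e3 : Real.exp (-c * x / 2) = E * Real.exp (-(c / 2) * (x - -1)) := by
          rw [hE, ← Real.exp_add]; congr 1; ring
        rw [e1, Real.sqrt_mul (by positivity), e2, Real.sqrt_sq (Real.exp_pos _).le, e3]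
        ring
      have h5 : |H (x + u) - H x| ≤
          |∫ y, (H (x - y + u) - H (x - y)) ∂P| + |r (x + u) - r x| := by
        rw [h1]; exact abs_add_le _ _
      linarith
  refine ⟨min δ 1, by positivity, fun {a b} hab => ?_⟩
  rw [Real.dist_eq] at hab ⊢
  have hab1 := hab.trans_le (min_le_left _ _)
  have hab2 := hab.trans_le (min_le_right _ _)
  rcases le_total a b with hle | hle
  · rw [abs_sub_comm] at hab1 hab2 ⊢
    rw [abs_of_nonneg (by linarith)] at hab1 hab2
    simpa using main (b - a) (by linarith) hab2.le hab1 a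
  · rw [abs_of_nonneg (by linarith)] at hab1 hab2
    simpa using main (a - b) (by linarith) hab2.le hab1 b

end IsRenewalSolution

end SplitTree

/-! ### Asymptotic periods and the renewal theorem -/

namespace SplitTree

open Topology

/-- If `D = E D(· - X) + o(1)` is bounded and uniformly continuous, `u` is an asymptotic upper bound
of `D`, and `D(τ n) → u` along a sequence `τ n → ∞`, then also `D(τ n - h) → u` for every `h` in the
support of the law of `X`: the functions `y ↦ D(τ n - y)` converge to `u` in `L¹`. -/
theorem tendsto_shift_of_tendsto_limsup {P : Measure ℝ} [IsProbabilityMeasure P]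
    {D r : ℝ → ℝ} {M u h : ℝ} (hD : UniformContinuous D) (hM : ∀ x, |D x| ≤ M)
    (hr : Tendsto r atTop (𝓝 0)) (heq : ∀ x, D x = ∫ y, D (x - y) ∂P + r x)
    (hu : ∀ ε > 0, ∀ᶠ x in atTop, D x < u + ε) (hh : h ∈ P.support)
    {τ : ℕ → ℝ} (hτ : Tendsto τ atTop atTop) (hDτ : Tendsto (fun n => D (τ n)) atTop (𝓝 u)) :
    Tendsto (fun n => D (τ n - h)) atTop (𝓝 u) := by
  have hDc := hD.continuous
  have hshift : ∀ y, Tendsto (fun n => τ n - y) atTop atTop := fun y =>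
    tendsto_atTop_add_const_right _ (-y) hτ
  have hint : ∀ n, Integrable (fun y => D (τ n - y)) P := fun n =>
    Integrable.of_bound (C := M) (by fun_prop) (Eventually.of_forall fun y => hM _)
  have hmean : Tendsto (fun n => ∫ y, D (τ n - y) ∂P) atTop (𝓝 u) := by
    have := hDτ.sub (hr.comp hτ)
    simp only [sub_zero] at this
    refine this.congr fun n => ?_
    simp only [Function.comp]
    linarith [heq (τ n)]
  have hpos : Tendsto (fun n => ∫ y, max (D (τ n - y) - u) 0 ∂P) atTop (𝓝 0) := by
    suffices h0 : Tendsto (fun n => ∫ y, max (D (τ n - y) - u) 0 ∂P) atTop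
        (𝓝 (∫ _, (0 : ℝ) ∂P)) by
      rwa [integral_zero] at h0
    refine tendsto_integral_of_dominated_convergence (fun _ => M + |u|) (fun n => by fun_prop)
      (integrable_const _) (fun n => Eventually.of_forall fun y => ?_)
      (Eventually.of_forall fun y => ?_)
    · rw [Real.norm_eq_abs, abs_of_nonneg (le_max_right _ _)]
      have h1 := le_abs_self (D (τ n - y))
      have h2 := neg_abs_le u
      have h3 := hM (τ n - y)
      have h4 := abs_nonneg u
      have h5 := abs_nonneg (D (τ n - y))
      exact max_le (by linarith) (by linarith)
    · rw [Metric.tendsto_atTop']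
      intro ε hε
      obtain ⟨N, hN⟩ := eventually_atTop.1 ((hshift y).eventually (hu ε hε))
      refine ⟨N, fun n hn => ?_⟩
      rw [Real.dist_eq, sub_zero, abs_of_nonneg (le_max_right _ _)]
      exact max_lt (by linarith [hN n hn.le]) hε
  have habs : Tendsto (fun n => ∫ y, |D (τ n - y) - u| ∂P) atTop (𝓝 0) := by
    have h1 := (hpos.const_mul 2).sub (hmean.sub_const u)
    simp only [mul_zero, sub_self] at h1
    refine h1.congr fun n => ?_
    have hi : Integrable (fun y => D (τ n - y) - u) P := (hint n).sub (integrable_const _)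
    have e : ∀ y, |D (τ n - y) - u| = 2 * max (D (τ n - y) - u) 0 - (D (τ n - y) - u) := by
      intro y
      rcases le_total (D (τ n - y) - u) 0 with h | h
      · rw [abs_of_nonpos h, max_eq_right h]; ring
      · rw [abs_of_nonneg h, max_eq_left h]; ring
    simp only [e]
    rw [integral_sub (hi.pos_part.const_mul 2) hi, integral_const_mul,
      integral_sub (hint n) (integrable_const _)]
    simp
  rw [Metric.tendsto_atTop']
  intro ε hε
  obtain ⟨δ, hδ, hδε⟩ := Metric.uniformContinuous_iff.1 hD (ε / 2) (half_pos hε)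
  set p := P.real (Metric.ball h δ) with hp
  have hp0 : 0 < p := ENNReal.toReal_pos
    ((Measure.mem_support_iff_forall h).1 hh _ (Metric.ball_mem_nhds h hδ)).ne' (measure_ne_top _ _)
  obtain ⟨N, hN⟩ := eventually_atTop.1 (habs.eventually (gt_mem_nhds
    (show 0 < p * (ε / 2) by positivity)))
  refine ⟨N, fun n hn => ?_⟩
  rw [Real.dist_eq]
  by_contra! hcon
  have hi : Integrable (fun y => |D (τ n - y) - u|) P := ((hint n).sub (integrable_const _)).abs
  have : p * (ε / 2) ≤ ∫ y, |D (τ n - y) - u| ∂P := by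
    calc p * (ε / 2) = ∫ _ in Metric.ball h δ, ε / 2 ∂P := by
          rw [setIntegral_const, smul_eq_mul]
      _ ≤ ∫ y in Metric.ball h δ, |D (τ n - y) - u| ∂P := by
          refine setIntegral_mono_on (integrable_const _).integrableOn hi.integrableOn
            measurableSet_ball fun y hy => ?_
          have h1 : |D (τ n - h) - D (τ n - y)| < ε / 2 := by
            have := hδε (a := τ n - h) (b := τ n - y) (by
              rw [Real.dist_eq, sub_sub_sub_cancel_left]; simpa [Real.dist_eq] using hy)
            simpa [Real.dist_eq] using this
          have h2 := abs_add_le (D (τ n - h) - D (τ n - y)) (D (τ n - y) - u)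
          rw [sub_add_sub_cancel] at h2
          linarith
      _ ≤ ∫ y, |D (τ n - y) - u| ∂P :=
          setIntegral_le_integral hi (Eventually.of_forall fun y => abs_nonneg _)
  linarith [hN n hn.le]

namespace IsRenewalSolution

variable {P : Measure ℝ} {c C : ℝ} {H r : ℝ → ℝ}

/-- If the increments `D = H(· + h) - H` had a positive limsup `u`, then there would be long runs
`t, t - h, …, t - k h` along which all increments are close to `u`, and `H` would be unbounded. -/
theorem eventually_increment_lt [IsProbabilityMeasure P] (hs : IsRenewalSolution P c C H r)
    (hP0 : ∀ᵐ y ∂P, 0 ≤ y) (hP : 0 < P (Ioi 0)) (hc : 0 < c) {h : ℝ} (hh : h ∈ P.support)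
    {ε : ℝ} (hε : 0 < ε) : ∀ᶠ x in atTop, H (x + h) - H x < ε := by
  obtain ⟨M, hM⟩ := hs.bounded hP0 hP hc
  have hHu := hs.uniformContinuous hP0 hP hc
  set D : ℝ → ℝ := fun x => H (x + h) - H x with hDdef
  have hDM : ∀ x, |D x| ≤ M + M := fun x => (abs_sub _ _).trans (add_le_add (hM _) (hM _))
  have hDu : UniformContinuous D :=
    (hHu.comp (uniformContinuous_id.add uniformContinuous_const)).sub hHu
  have hDeq : ∀ x, D x = ∫ y, D (x - y) ∂P + (r (x + h) - r x) := by
    intro x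
    have h2 : ∀ y, x - y + h = x + h - y := fun y => by ring
    simp only [hDdef, h2]
    rw [integral_sub (hs.integrable hP0 _) (hs.integrable hP0 _)]
    linarith [hs.eq x, hs.eq (x + h)]
  have hr : Tendsto (fun x => r (x + h) - r x) atTop (𝓝 0) := by
    have h1 := hs.tendsto_source hc
    simpa using (h1.comp (tendsto_atTop_add_const_right _ h tendsto_id)).sub h1
  set u := limsup D atTop with hu
  have hbddu : IsBoundedUnder (· ≤ ·) atTop D :=
    isBoundedUnder_of ⟨M + M, fun x => (le_abs_self _).trans (hDM x)⟩
  have hbddl : IsBoundedUnder (· ≥ ·) atTop D :=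
    isBoundedUnder_of ⟨-(M + M), fun x => (abs_le.1 (hDM x)).1⟩
  have hup : ∀ ε > 0, ∀ᶠ x in atTop, D x < u + ε := fun ε hε =>
    eventually_lt_of_limsup_lt (by linarith) hbddu
  rcases le_or_gt u 0 with hu0 | hu0
  · filter_upwards [hup ε hε] with x hx
    linarith
  exfalso
  have hfreq : ∀ n : ℕ, ∃ x, (n : ℝ) ≤ x ∧ u - 1 / ((n : ℝ) + 1) < D x := by
    intro n
    have : ∃ᶠ x in atTop, u - 1 / ((n : ℝ) + 1) < D x :=
      frequently_lt_of_lt_limsup hbddl.isCoboundedUnder_le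
        (by rw [← hu]; have : (0 : ℝ) < 1 / ((n : ℝ) + 1) := by positivity
            linarith)
    obtain ⟨x, h1, h2⟩ := (this.and_eventually (eventually_ge_atTop (n : ℝ))).exists
    exact ⟨x, h2, h1⟩
  choose τ hτn hτD using hfreq
  have hτ : Tendsto τ atTop atTop := tendsto_atTop_mono hτn tendsto_natCast_atTop_atTop
  have hDτ : Tendsto (fun n => D (τ n)) atTop (𝓝 u) := by
    rw [Metric.tendsto_atTop']
    intro ε hε
    obtain ⟨N, hN⟩ := eventually_atTop.1 ((hτ.eventually (hup ε hε)).and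
      (tendsto_one_div_add_atTop_nhds_zero_nat.eventually (gt_mem_nhds hε)))
    refine ⟨N, fun n hn => ?_⟩
    obtain ⟨h1, h2⟩ := hN n hn.le
    rw [Real.dist_eq, abs_lt]
    constructor <;> linarith [hτD n]
  have hk : ∀ k : ℕ, Tendsto (fun n => τ n - k * h) atTop atTop ∧
      Tendsto (fun n => D (τ n - k * h)) atTop (𝓝 u) := by
    intro k
    refine ⟨tendsto_atTop_add_const_right _ _ hτ, ?_⟩
    induction k with
    | zero => simpa using hDτ
    | succ k ih =>
      have := tendsto_shift_of_tendsto_limsup hDu hDM hr hDeq hup hh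
        (tendsto_atTop_add_const_right _ (-(k * h)) hτ) ih
      refine this.congr fun n => ?_
      congr 1; push_cast; ring
  have hsum : ∀ K : ℕ, K * u ≤ M + M := by
    intro K
    have h1 : Tendsto (fun n => ∑ k ∈ Finset.range K, D (τ n - k * h)) atTop
        (𝓝 (∑ _k ∈ Finset.range K, u)) := tendsto_finsetSum _ fun k _ => (hk k).2
    rw [Finset.sum_const, Finset.card_range, nsmul_eq_mul] at h1
    refine le_of_tendsto' h1 fun n => ?_
    have h2 : ∀ K : ℕ, ∑ k ∈ Finset.range K, D (τ n - k * h) =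
        H (τ n + h) - H (τ n + h - K * h) := by
      intro K
      induction K with
      | zero => simp
      | succ K ih =>
        rw [Finset.sum_range_succ, ih]
        simp only [hDdef]
        rw [show τ n - K * h + h = τ n + h - K * h by ring,
          show τ n + h - (K + 1 : ℕ) * h = τ n - K * h by push_cast; ring]
        ring
    rw [h2]
    linarith [(abs_le.1 (hM (τ n + h))).2, (abs_le.1 (hM (τ n + h - K * h))).1]
  obtain ⟨K, hK⟩ := exists_nat_gt ((M + M) / u)
  rw [div_lt_iff₀ hu0] at hK
  linarith [hsum K]

end IsRenewalSolution

/-- The asymptotic periods of `H`: the `h` with `H(x + h) - H(x) → 0` as `x → ∞`. -/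
def asymptoticPeriods (H : ℝ → ℝ) : AddSubgroup ℝ where
  carrier := {h | Tendsto (fun x => H (x + h) - H x) atTop (𝓝 0)}
  zero_mem' := by simp
  add_mem' := by
    intro a b ha hb
    have h1 := (Tendsto.comp (mem_ofPred.1 hb) (tendsto_atTop_add_const_right _ a tendsto_id)).add
      (mem_ofPred.1 ha)
    simp only [add_zero] at h1
    refine h1.congr fun x => ?_
    simp only [Function.comp, id]
    rw [show x + (a + b) = x + a + b by ring]; ring
  neg_mem' := by
    intro a ha
    have h1 := (Tendsto.comp (mem_ofPred.1 ha)
      (tendsto_atTop_add_const_right _ (-a) tendsto_id)).neg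
    simp only [neg_zero] at h1
    refine h1.congr fun x => ?_
    simp only [Function.comp, id]
    rw [show x + -a + a = x by ring]; ring

theorem mem_asymptoticPeriods {H : ℝ → ℝ} {h : ℝ} :
    h ∈ asymptoticPeriods H ↔ Tendsto (fun x => H (x + h) - H x) atTop (𝓝 0) := Iff.rfl

theorem isClosed_asymptoticPeriods {H : ℝ → ℝ} (hH : UniformContinuous H) :
    IsClosed (asymptoticPeriods H : Set ℝ) := by
  refine isClosed_of_closure_subset fun h hh => ?_
  rw [SetLike.mem_coe, mem_asymptoticPeriods, Metric.tendsto_atTop']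
  intro ε hε
  obtain ⟨δ, hδ, hδε⟩ := Metric.uniformContinuous_iff.1 hH (ε / 2) (half_pos hε)
  obtain ⟨a, ha, hha⟩ := Metric.mem_closure_iff.1 hh δ hδ
  obtain ⟨N, hN⟩ := Metric.tendsto_atTop'.1 (mem_asymptoticPeriods.1 ha) (ε / 2) (half_pos hε)
  refine ⟨N, fun x hx => ?_⟩
  have h1 := hN x hx
  have h2 := hδε (a := x + h) (b := x + a) (by simpa using hha)
  rw [Real.dist_eq] at h1 h2 ⊢
  rw [sub_zero] at h1 ⊢
  have := abs_add_le (H (x + h) - H (x + a)) (H (x + a) - H x)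
  rw [sub_add_sub_cancel] at this
  linarith

theorem asymptoticPeriods_neg (H : ℝ → ℝ) :
    asymptoticPeriods (fun x => -H x) = asymptoticPeriods H := by
  ext h
  rw [mem_asymptoticPeriods, mem_asymptoticPeriods]
  constructor <;> intro h1
  · simpa using (h1.neg).congr fun x => by ring
  · simpa using (h1.neg).congr fun x => by ring

/-- Convergence of the increments is uniform over the asymptotic periods in a compact interval. -/
theorem eventually_increment_lt_of_mem_Icc {H : ℝ → ℝ} (hH : UniformContinuous H) (W : ℝ) {ε : ℝ}
    (hε : 0 < ε) :
    ∀ᶠ x in atTop, ∀ y ∈ asymptoticPeriods H, y ∈ Icc 0 W → |H (x - y) - H x| < ε := by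
  obtain ⟨δ, hδ, hδε⟩ := Metric.uniformContinuous_iff.1 hH (ε / 2) (half_pos hε)
  have hcomp : IsCompact ((asymptoticPeriods H : Set ℝ) ∩ Icc 0 W) :=
    isCompact_Icc.inter_left (isClosed_asymptoticPeriods hH)
  obtain ⟨F, hFs, hFf, hcov⟩ := hcomp.finite_cover_balls hδ
  have h1 : ∀ᶠ x in atTop, ∀ a ∈ F, |H (x - a) - H x| < ε / 2 := by
    rw [hFf.eventually_all]
    intro a ha
    have := mem_asymptoticPeriods.1 ((asymptoticPeriods H).neg_mem (hFs ha).1)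
    filter_upwards [Metric.tendsto_nhds.1 this (ε / 2) (half_pos hε)] with x hx
    simpa [Real.dist_eq, sub_eq_add_neg] using hx
  filter_upwards [h1] with x hx y hy hyW
  obtain ⟨a, ha, hya⟩ := mem_iUnion₂.1 (hcov ⟨hy, hyW⟩)
  have h2 := hδε (a := x - y) (b := x - a) (by
    rw [Real.dist_eq, sub_sub_sub_cancel_left, abs_sub_comm]; simpa [Real.dist_eq] using hya)
  rw [Real.dist_eq] at h2
  have := abs_add_le (H (x - y) - H (x - a)) (H (x - a) - H x)
  rw [sub_add_sub_cancel] at this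
  linarith [hx a ha]

namespace IsRenewalSolution

variable {P : Measure ℝ} {c C : ℝ} {H r : ℝ → ℝ}

theorem support_subset_asymptoticPeriods [IsProbabilityMeasure P]
    (hs : IsRenewalSolution P c C H r) (hP0 : ∀ᵐ y ∂P, 0 ≤ y) (hP : 0 < P (Ioi 0)) (hc : 0 < c) :
    P.support ⊆ asymptoticPeriods H := by
  intro h hh
  rw [SetLike.mem_coe, mem_asymptoticPeriods, Metric.tendsto_nhds]
  intro ε hε
  filter_upwards [hs.eventually_increment_lt hP0 hP hc hh hε,
    hs.neg.eventually_increment_lt hP0 hP hc hh hε] with x h1 h2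
  rw [Real.dist_eq, sub_zero, abs_lt]
  constructor <;> linarith

/-- A solution of the renewal equation is asymptotically almost nondecreasing along translates of
its group of asymptotic periods. If `H` is at least `a` on a long window before `t`, then the process
of partial sums started at a later point `x` will, with a probability close to one, hit that window,
and the source collected on the way is negligible; this is the bound for subsolutions applied
to `(a - H)⁺`. -/
theorem eventually_sub_le [IsProbabilityMeasure P]
    (hs : IsRenewalSolution P c C H r) (hP0 : ∀ᵐ y ∂P, 0 ≤ y) (hP : 0 < P (Ioi 0)) (hc : 0 < c)
    (hexp : Integrable (fun y => Real.exp (c * y)) P) {ε : ℝ} (hε : 0 < ε) :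
    ∀ᶠ t in atTop, ∀ h ∈ asymptoticPeriods H, 0 ≤ h → H t - ε ≤ H (t + h) := by
  obtain ⟨M, hM⟩ := hs.bounded hP0 hP hc
  have hHu := hs.uniformContinuous hP0 hP hc
  obtain ⟨K, hK0, hK⟩ := exists_bound_of_subsolution hP0 hP hc
  set E := ∫ y, Real.exp (c * y) ∂P with hE
  have hE0 : 0 ≤ E := integral_nonneg fun y => (Real.exp_pos _).le
  have hM0 : 0 ≤ M := (abs_nonneg _).trans (hM 0)
  have hC := hs.const_nonneg
  have hlim : ∀ B : ℝ, Tendsto (fun W : ℝ => K * (B * Real.exp (-c * W))) atTop (𝓝 0) := by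
    intro B
    have h1 : Tendsto (fun x : ℝ => -c * x) atTop atBot :=
      tendsto_id.const_mul_atTop_of_neg (by linarith)
    simpa using ((Real.tendsto_exp_atBot.comp h1).const_mul B).const_mul K
  obtain ⟨W, hW, hW0⟩ := (((hlim (2 * M * E)).eventually (gt_mem_nhds
    (show 0 < ε / 4 by positivity))).and (eventually_ge_atTop 0)).exists
  filter_upwards [eventually_increment_lt_of_mem_Icc hHu W (half_pos hε),
    (hlim C).eventually (gt_mem_nhds (show 0 < ε / 4 by positivity))] with t ht1 ht2 h hh hh0
  set G := asymptoticPeriods H with hG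
  set a := H t - ε / 2 with ha
  have haM : ∀ x, a - H x ≤ 2 * M := fun x => by
    linarith [(abs_le.1 (hM x)).1, (abs_le.1 (hM t)).2]
  -- The indicator restricts to the translate of `G` through `t`, which the steps almost surely
  -- preserve and on which `H` is controlled before time `t`.
  set S : Set ℝ := {x | t ≤ x ∧ x - t ∈ G} with hS
  have hSm : MeasurableSet S := by
    have h1 : IsClosed S := isClosed_Ici.inter
      ((isClosed_asymptoticPeriods hHu).preimage (continuous_id.sub continuous_const))
    exact h1.measurableSet
  set g : ℝ → ℝ := S.indicator fun x => max (a - H x) 0 with hg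
  have hgm : Measurable g := by
    have := hs.continuous
    exact Measurable.indicator (Continuous.measurable (by fun_prop)) hSm
  have hg0 : ∀ x, 0 ≤ g x := fun x => indicator_nonneg (fun _ _ => le_max_right _ _) _
  have hgM : ∀ x, g x ≤ 2 * M := fun x =>
    indicator_apply_le' (fun _ => max_le (haM _) (by positivity)) fun _ => by positivity
  have hsupp : ∀ᵐ y ∂P, y ∈ G := by
    filter_upwards [Measure.support_mem_ae (μ := P)] with y hy
    exact hs.support_subset_asymptoticPeriods hP0 hP hc hy
  have key := hK g t (2 * M * E * Real.exp (-c * W) + C * Real.exp (-c * t)) hgm hg0 ?_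
    (fun T => ⟨2 * M, fun x _ => hgM x⟩) (by positivity) ?_ (t + h)
  · have h1 : t + h ∈ S := ⟨by linarith, by simpa using hh⟩
    rw [hg, indicator_of_mem h1] at key
    have := le_max_left (a - H (t + h)) 0
    linarith
  · intro x hx
    exact indicator_of_notMem (fun h => absurd h.1 (not_le.2 hx)) _
  · intro x hx
    set R := (2 * M * E * Real.exp (-c * W) + C * Real.exp (-c * t)) * Real.exp (-c * (x - t))
      with hR
    have hR0 : 0 ≤ R := by positivity
    have hgi : Integrable (fun y => g (x - y)) P :=
      integrable_comp_sub_of_bounded (M := 2 * M) hP0 hgm fun z _ => by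
        rw [abs_of_nonneg (hg0 z)]; exact hgM z
    by_cases hxS : x ∈ S
    swap
    · rw [hg, indicator_of_notMem hxS]
      exact add_nonneg (integral_nonneg fun y => hg0 _) hR0
    rw [hg, indicator_of_mem hxS, ← hg]
    refine max_le ?_ (add_nonneg (integral_nonneg fun y => hg0 _) hR0)
    have h1 : a - H x = ∫ y, (a - H (x - y)) ∂P - r x := by
      rw [integral_sub (integrable_const _) (hs.integrable hP0 x)]
      simp only [integral_const, probReal_univ, smul_eq_mul, one_mul]
      linarith [hs.eq x]
    -- From `x ≥ t`, only a step longer than `x - t + W` jumps over the window `[t - W, t]`.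
    set A := 2 * M * Real.exp (-c * (x - t + W)) with hA
    have h2 : ∫ y, (a - H (x - y)) ∂P ≤ ∫ y, (g (x - y) + A * Real.exp (c * y)) ∂P := by
      refine integral_mono_ae ((integrable_const _).sub (hs.integrable hP0 x))
        (hgi.add (hexp.const_mul A)) ?_
      filter_upwards [hP0, hsupp] with y hy hyG
      have hAy : 0 ≤ A * Real.exp (c * y) := by positivity
      have hmem : x - y - t ∈ G := by
        rw [show x - y - t = x - t - y by ring]; exact G.sub_mem hxS.2 hyG
      rcases le_or_gt t (x - y) with hty | hty
      · have h3 : x - y ∈ S := ⟨hty, hmem⟩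
        have h4 : g (x - y) = max (a - H (x - y)) 0 := by rw [hg, indicator_of_mem h3]
        rw [h4]
        linarith [le_max_left (a - H (x - y)) 0]
      · have h0 := hg0 (x - y)
        rcases le_or_gt (t - W) (x - y) with hw | hw
        · have h3 := ht1 (t - (x - y)) (by
            rw [show t - (x - y) = -(x - y - t) by ring]; exact G.neg_mem hmem)
            ⟨by linarith, by linarith⟩
          rw [sub_sub_cancel] at h3
          linarith [(abs_lt.1 h3).1]
        · have h3 : A * Real.exp (c * y) = 2 * M * Real.exp (c * (y - (x - t + W))) := by
            rw [hA, mul_assoc, ← Real.exp_add]; congr 2; ring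
          have h4 : 1 ≤ Real.exp (c * (y - (x - t + W))) :=
            Real.one_le_exp (mul_nonneg hc.le (by linarith))
          have h5 : 2 * M * 1 ≤ 2 * M * Real.exp (c * (y - (x - t + W))) := by gcongr
          linarith [haM (x - y)]
    rw [integral_add hgi (hexp.const_mul A), integral_const_mul, ← hE] at h2
    have h3 : A * E = 2 * M * E * Real.exp (-c * W) * Real.exp (-c * (x - t)) := by
      rw [hA, mul_assoc (2 * M * E), ← Real.exp_add,
        show -c * W + -c * (x - t) = -c * (x - t + W) by ring]
      ring
    have h4 : C * Real.exp (-c * x) = C * Real.exp (-c * t) * Real.exp (-c * (x - t)) := by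
      rw [mul_assoc, ← Real.exp_add]; congr 2; ring
    have h5 := (abs_le.1 (hs.decay x)).1
    have h6 : R = A * E + C * Real.exp (-c * x) := by rw [hR, h3, h4]; ring
    linarith

/-- **Renewal theorem.** A solution of the renewal equation with exponentially decaying source is
asymptotic to a continuous function invariant under the closed group generated by the support of the
step law. -/
theorem exists_periodic_limit [IsProbabilityMeasure P]
    (hs : IsRenewalSolution P c C H r) (hP0 : ∀ᵐ y ∂P, 0 ≤ y) (hP : 0 < P (Ioi 0)) (hc : 0 < c)
    (hexp : Integrable (fun y => Real.exp (c * y)) P) :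
    ∃ L : ℝ → ℝ, Continuous L ∧
      (∀ h ∈ (AddSubgroup.closure P.support).topologicalClosure, ∀ x, L (x + h) = L x) ∧
      Tendsto (fun x => H x - L x) atTop (𝓝 0) := by
  have hHu := hs.uniformContinuous hP0 hP hc
  have hsup := hs.support_subset_asymptoticPeriods hP0 hP hc
  have hgrp : (AddSubgroup.closure P.support).topologicalClosure ≤ asymptoticPeriods H :=
    AddSubgroup.topologicalClosure_minimal _ ((AddSubgroup.closure_le _).2 hsup)
      (isClosed_asymptoticPeriods hHu)
  have hclose : ∀ ε > 0, ∀ᶠ t in atTop, ∀ h ∈ asymptoticPeriods H, 0 ≤ h →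
      |H (t + h) - H t| ≤ ε := by
    intro ε hε
    filter_upwards [hs.eventually_sub_le hP0 hP hc hexp hε,
      hs.neg.eventually_sub_le hP0 hP hc hexp hε] with t h1 h2 h hh hh0
    rw [asymptoticPeriods_neg] at h2
    rw [abs_le]
    constructor <;> linarith [h1 h hh hh0, h2 h hh hh0]
  obtain ⟨a, ha0, haP⟩ := Measure.nonempty_inter_support_of_pos hP
  have ha0 : 0 < a := ha0
  have haG : a ∈ asymptoticPeriods H := hsup haP
  have hka : ∀ x, Tendsto (fun k : ℕ => x + k * a) atTop atTop := fun x =>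
    tendsto_atTop_add_const_left _ _ (tendsto_natCast_atTop_atTop.atTop_mul_const ha0)
  have hcau : ∀ x, ∃ l, Tendsto (fun k : ℕ => H (x + k * a)) atTop (𝓝 l) := by
    intro x
    refine cauchySeq_tendsto_of_complete (Metric.cauchySeq_iff'.2 fun ε hε => ?_)
    obtain ⟨N, hN⟩ := ((hka x).eventually (hclose (ε / 2) (half_pos hε))).exists
    refine ⟨N, fun n hn => ?_⟩
    have h1 := hN (((n - N : ℕ) : ℝ) * a)
      (by simpa using (asymptoticPeriods H).nsmul_mem haG (n - N)) (by positivity)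
    rw [Nat.cast_sub hn, show x + N * a + (n - N) * a = x + n * a by ring] at h1
    rw [Real.dist_eq]; linarith
  choose L hL using hcau
  refine ⟨L, ?_, ?_, ?_⟩
  · refine UniformContinuous.continuous (Metric.uniformContinuous_iff.2 fun ε hε => ?_)
    obtain ⟨δ, hδ, hδε⟩ := Metric.uniformContinuous_iff.1 hHu (ε / 2) (half_pos hε)
    refine ⟨δ, hδ, fun {x y} hxy => ?_⟩
    have h1 : dist (L x) (L y) ≤ ε / 2 :=
      le_of_tendsto' ((hL x).dist (hL y)) fun k => (hδε (by simpa using hxy)).le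
    linarith
  · intro h hh x
    have h1 := (mem_asymptoticPeriods.1 (hgrp hh)).comp (hka x)
    have h2 := (hL (x + h)).sub (hL x)
    have h3 := tendsto_nhds_unique h2 (h1.congr fun k => by
      simp only [Function.comp]; rw [show x + k * a + h = x + h + k * a by ring])
    linarith
  · rw [Metric.tendsto_nhds]
    intro ε hε
    filter_upwards [hclose (ε / 2) (half_pos hε)] with x hx
    have h1 : |L x - H x| ≤ ε / 2 :=
      le_of_tendsto' (((hL x).sub_const _).abs) fun k => hx (k * a)
        (by simpa using (asymptoticPeriods H).nsmul_mem haG k) (by positivity)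
    rw [Real.dist_eq, sub_zero, abs_sub_comm]
    linarith

end IsRenewalSolution

end SplitTree

/-! ### Binomial means and the expectations over the levels of the tree -/

namespace SplitTree

open ProbabilityTheory

/-- The mean of `φ` under the binomial distribution with `m` trials, success weight `p` and failure
weight `q`, by conditioning on one trial. It is used for real and for extended nonnegative
weights. -/
def binomialMean {R : Type*} [CommSemiring R] (p q : R) : ℕ → (ℕ → R) → R
  | 0, φ => φ 0
  | m + 1, φ => p * binomialMean p q m (fun j => φ (j + 1)) + q * binomialMean p q m φ

section BinomialMean

variable {R : Type*} [CommSemiring R] (p q : R)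

theorem binomialMean_congr {m : ℕ} {φ ψ : ℕ → R} (h : ∀ j ≤ m, φ j = ψ j) :
    binomialMean p q m φ = binomialMean p q m ψ := by
  induction m generalizing φ ψ with
  | zero => exact h 0 le_rfl
  | succ m ih =>
    rw [binomialMean, binomialMean, ih fun j hj => h (j + 1) (by omega),
      ih fun j hj => h j (by omega)]

theorem binomialMean_add (m : ℕ) (φ ψ : ℕ → R) :
    binomialMean p q m (fun j => φ j + ψ j) = binomialMean p q m φ + binomialMean p q m ψ := by
  induction m generalizing φ ψ with
  | zero => rfl
  | succ m ih => simp only [binomialMean, ih]; ring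

theorem binomialMean_const_mul (m : ℕ) (c : R) (φ : ℕ → R) :
    binomialMean p q m (fun j => c * φ j) = c * binomialMean p q m φ := by
  induction m generalizing φ with
  | zero => rfl
  | succ m ih => simp only [binomialMean, ih]; ring

variable {p q}

theorem binomialMean_const (hpq : p + q = 1) (m : ℕ) (c : R) :
    binomialMean p q m (fun _ => c) = c := by
  induction m with
  | zero => rfl
  | succ m ih => simp only [binomialMean, ih]; rw [← add_mul, hpq, one_mul]

theorem binomialMean_natCast (hpq : p + q = 1) (m : ℕ) :
    binomialMean p q m (fun j => (j : R)) = m * p := by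
  induction m with
  | zero => simp [binomialMean]
  | succ m ih =>
    simp only [binomialMean, Nat.cast_add, Nat.cast_one, binomialMean_add, ih,
      binomialMean_const hpq]
    calc p * (m * p + 1) + q * (m * p) = (p + q) * (m * p) + p := by ring
      _ = (m + 1) * p := by rw [hpq]; ring

/-- All `m` trials succeed with probability `p ^ m`. -/
theorem binomialMean_top (p q : R) (m : ℕ) :
    binomialMean p q m (fun j => if j = m then 1 else 0) = p ^ m := by
  induction m with
  | zero => simp [binomialMean]
  | succ m ih =>
    have h0 : binomialMean p q m (fun j => if j = m + 1 then (1 : R) else 0) = 0 := by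
      rw [binomialMean_congr p q (ψ := fun _ => 0 * 0) fun j hj => by
        rw [if_neg (by omega)]; ring, binomialMean_const_mul]
      ring
    simp only [binomialMean, Nat.add_right_cancel_iff, ih, h0]
    ring

end BinomialMean

/-- Real and extended nonnegative binomial means agree. -/
theorem binomialMean_ofReal {p q : ℝ} (hp : 0 ≤ p) (hq : 0 ≤ q) (m : ℕ) {φ : ℕ → ℝ}
    (hφ : ∀ j, 0 ≤ φ j) :
    0 ≤ binomialMean p q m φ ∧
    binomialMean (ENNReal.ofReal p) (ENNReal.ofReal q) m (fun j => ENNReal.ofReal (φ j)) =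
      ENNReal.ofReal (binomialMean p q m φ) := by
  induction m generalizing φ with
  | zero => exact ⟨hφ 0, rfl⟩
  | succ m ih =>
    obtain ⟨h1, h2⟩ := ih hφ
    obtain ⟨h3, h4⟩ := ih fun j => hφ (j + 1)
    refine ⟨by rw [binomialMean]; positivity, ?_⟩
    rw [binomialMean, binomialMean, h2, h4, ENNReal.ofReal_add (by positivity) (by positivity),
      ENNReal.ofReal_mul hp, ENNReal.ofReal_mul hq]

/-- In a product measure, a function of the coordinates in a finite set `S` is independent of every
coordinate outside `S`. -/
theorem lintegral_infinitePi_of_dependsOn {ι X α : Type*} [MeasurableSpace X] [MeasurableSpace α]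
    (μ : ι → Measure X) [∀ i, IsProbabilityMeasure (μ i)] {S : Finset ι} {j : ι} (hj : j ∉ S)
    {g : (ι → X) → α} (hg : Measurable g) (hdep : DependsOn g S) {F : α → X → ℝ≥0∞}
    (hF : Measurable (Function.uncurry F)) :
    ∫⁻ ω, F (g ω) (ω j) ∂Measure.infinitePi μ =
      ∫⁻ ω, ∫⁻ x, F (g ω) x ∂μ j ∂Measure.infinitePi μ := by
  classical
  have hne : Nonempty X := (inferInstance : NeZero (μ j)) |>.ne |> fun h => by
    by_contra hX
    rw [not_nonempty_iff] at hX
    exact h (Measure.eq_zero_of_isEmpty _)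
  obtain ⟨x₀⟩ := hne
  have hext : Measurable fun (y : S → X) (i : ι) => if h : i ∈ S then y ⟨i, h⟩ else x₀ := by
    refine measurable_pi_lambda _ fun i => ?_
    by_cases h : i ∈ S
    · simpa [h] using measurable_pi_apply (⟨i, h⟩ : S)
    · simp [h]
  have hind : IndepFun g (fun ω : ι → X => ω j) (Measure.infinitePi μ) := by
    have h1 := (iIndepFun_infinitePi (P := μ) (X := fun _ x => x)
      (fun _ => measurable_id)).indepFun_finset S {j} (by simpa using hj)
      (fun i => measurable_pi_apply i)
    have h2 := h1.comp (hg.comp hext)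
      (measurable_pi_apply (⟨j, by simp⟩ : ({j} : Finset ι)))
    refine (h2.congr (Eventually.of_forall fun ω => ?_) (Eventually.of_forall fun ω => rfl))
    refine hdep fun i hi => ?_
    have hi : i ∈ S := hi
    simp [hi]
  have hmj : Measurable fun ω : ι → X => ω j := measurable_pi_apply j
  calc ∫⁻ ω, F (g ω) (ω j) ∂Measure.infinitePi μ
      = ∫⁻ z, Function.uncurry F z ∂(Measure.infinitePi μ).map fun ω => (g ω, ω j) := by
        rw [lintegral_map hF (hg.prodMk hmj)]; rfl
    _ = ∫⁻ z, Function.uncurry F z ∂((Measure.infinitePi μ).map g).prod (μ j) := by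
        rw [hind.map_prod_eq_prod_map_map hg.aemeasurable hmj.aemeasurable,
          Measure.infinitePi_map_eval]
    _ = ∫⁻ ω, ∫⁻ x, F (g ω) x ∂μ j ∂Measure.infinitePi μ := by
        rw [lintegral_prod _ hF.aemeasurable, lintegral_map hF.lintegral_prod_right' hg]
        rfl

section Count

variable {b : ℕ}

theorem measurableSet_selects (i : Fin b) (j : ℕ) :
    MeasurableSet {D : NodeData b | Selects D.1 (D.2 j) i} := by
  have h1 : ∀ s : Finset (Fin b), Measurable fun D : NodeData b => ∑ k ∈ s, D.1 k := fun s => by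
    fun_prop
  have h2 : Measurable fun D : NodeData b => (D.2 j : ℝ) := by fun_prop
  exact (measurableSet_le (h1 _) h2).inter (measurableSet_lt h2 (h1 _))

theorem count_succ (D : NodeData b) (m : ℕ) (i : Fin b) [Decidable (Selects D.1 (D.2 m) i)] :
    count D (m + 1) i = count D m i + if Selects D.1 (D.2 m) i then 1 else 0 := by
  classical
  rw [count, count, Finset.range_add_one, Finset.filter_insert]
  by_cases h : Selects D.1 (D.2 m) i
  · rw [if_pos h, if_pos h, Finset.card_insert_of_notMem (by simp)]
  · rw [if_neg h, if_neg h, add_zero]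

theorem count_le (D : NodeData b) (m : ℕ) (i : Fin b) : count D m i ≤ m := by
  classical
  exact (Finset.card_filter_le _ _).trans (by simp)

theorem measurable_count (m : ℕ) (i : Fin b) : Measurable fun D : NodeData b => count D m i := by
  classical
  induction m with
  | zero => simp [count]
  | succ m ih =>
    simp only [count_succ]
    exact ih.add (Measurable.ite (measurableSet_selects i m) measurable_const measurable_const)

theorem volume_selects {v : Fin b → ℝ} (hv : ∀ i, 0 ≤ v i) (hv1 : ∑ i, v i = 1) (i : Fin b) :
    volume {x : I | Selects v x i} = ENNReal.ofReal (v i) := by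
  have hle : ∀ s : Finset (Fin b), ∑ k ∈ s, v k ≤ 1 := fun s => by
    rw [← hv1]
    exact Finset.sum_le_univ_sum_of_nonneg hv
  have h0 : ∀ s : Finset (Fin b), 0 ≤ ∑ k ∈ s, v k := fun s => Finset.sum_nonneg fun k _ => hv k
  have : {x : I | Selects v x i} =
      Ico (⟨∑ k ∈ Finset.Iio i, v k, h0 _, hle _⟩ : I) ⟨∑ k ∈ Finset.Iic i, v k, h0 _, hle _⟩ := by
    ext x
    simp only [Selects, mem_Ico, ← Subtype.coe_le_coe, ← Subtype.coe_lt_coe]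
    rfl
  rw [this, unitInterval.volume_Ico]
  have hsum : ∑ k ∈ Finset.Iic i, v k = v i + ∑ k ∈ Finset.Iio i, v k := by
    rw [← Finset.Iio_insert, Finset.sum_insert (by simp)]
  congr 1
  linarith

/-- Given the split vector, the number of items that choose child `i` is binomially distributed. -/
theorem lintegral_count {v : Fin b → ℝ} (hv : ∀ i, 0 ≤ v i) (hv1 : ∑ i, v i = 1) (i : Fin b)
    (m : ℕ) (φ : ℕ → ℝ≥0∞) :
    ∫⁻ x, φ (count (v, x) m i) ∂Measure.infinitePi (fun _ : ℕ => (volume : Measure I)) =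
      binomialMean (ENNReal.ofReal (v i)) (ENNReal.ofReal (1 - v i)) m φ := by
  classical
  induction m generalizing φ with
  | zero => simp [count, binomialMean]
  | succ m ih =>
    have hS : MeasurableSet {x : I | Selects v x i} := by
      have h1 : Measurable fun x : I => (x : ℝ) := by fun_prop
      exact (measurableSet_le measurable_const h1).inter (measurableSet_lt h1 measurable_const)
    have hSc : volume {x : I | Selects v x i}ᶜ = ENNReal.ofReal (1 - v i) := by
      rw [prob_compl_eq_one_sub hS, volume_selects hv hv1, ENNReal.ofReal_sub _ (hv i)]
      simp
    set F : ℕ → I → ℝ≥0∞ := fun k x => φ (k + if Selects v x i then 1 else 0) with hF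
    have hFm : Measurable (Function.uncurry F) := by
      refine measurable_from_prod_countable_right fun k => ?_
      have h1 : Measurable fun x : I => k + if Selects v x i then 1 else 0 :=
        measurable_const.add (Measurable.ite hS measurable_const measurable_const)
      exact (measurable_of_countable φ).comp h1
    have hFi : ∀ k, ∫⁻ x, F k x = ENNReal.ofReal (v i) * φ (k + 1) +
        ENNReal.ofReal (1 - v i) * φ k := by
      intro k
      rw [← lintegral_add_compl _ hS,
        setLIntegral_congr_fun hS (g := fun _ => φ (k + 1)) fun x hx => by
          have hx : Selects v x i := hx
          simp [hF, hx],
        setLIntegral_congr_fun hS.compl (g := fun _ => φ k) fun x hx => by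
          have hx : ¬ Selects v x i := hx
          simp [hF, hx],
        setLIntegral_const, setLIntegral_const, volume_selects hv hv1, hSc]
      ring
    have hmeas : Measurable fun x : ℕ → I => count (v, x) m i :=
      (measurable_count m i).comp (measurable_const.prodMk measurable_id)
    have key := lintegral_infinitePi_of_dependsOn (fun _ : ℕ => (volume : Measure I))
      (S := Finset.range m) (j := m) (by simp) hmeas (fun x y hxy => by
        simp only [count]
        congr 1
        refine Finset.filter_congr fun k hk => ?_
        rw [hxy k (by simpa using hk)]) hFm
    calc ∫⁻ x, φ (count (v, x) (m + 1) i) ∂Measure.infinitePi (fun _ : ℕ => (volume : Measure I))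
        = ∫⁻ x, F (count (v, x) m i) (x m) ∂Measure.infinitePi
            (fun _ : ℕ => (volume : Measure I)) := by
          simp only [count_succ, hF]
      _ = _ := by
          rw [key]
          simp only [hFi]
          have hm1 : ∀ ψ : ℕ → ℝ≥0∞, Measurable fun x : ℕ → I => ψ (count (v, x) m i) := fun ψ =>
            (measurable_of_countable ψ).comp hmeas
          rw [lintegral_add_left ((hm1 fun k => φ (k + 1)).const_mul _),
            lintegral_const_mul _ (hm1 fun k => φ (k + 1)), lintegral_const_mul _ (hm1 φ),
            ih fun k => φ (k + 1), ih φ, binomialMean]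

end Count

/-- The law of the randomness at one node. -/
noncomputable abbrev nodeLaw {b : ℕ} (ν : Measure (Fin b → ℝ)) : Measure (NodeData b) :=
  ν.prod (Measure.infinitePi fun _ : ℕ => (volume : Measure I))

/-- The cardinality of child `i` of a node with cardinality `n` and randomness `D`. -/
noncomputable def childSize {b : ℕ} (s s₀ s₁ n : ℕ) (D : NodeData b) (i : Fin b) : ℕ :=
  if s < n then s₁ + count D (n - s₀ - b * s₁) i else 0

/-- The branching operator: `(Tφ)(n)` is the expected sum of `φ` over the cardinalities of the
children of a node with cardinality `n`. -/
noncomputable def branchOp {b : ℕ} (ν : Measure (Fin b → ℝ)) (s s₀ s₁ : ℕ) (φ : ℕ → ℝ≥0∞) (n : ℕ) :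
    ℝ≥0∞ :=
  ∑ i, ∫⁻ D, φ (childSize s s₀ s₁ n D i) ∂nodeLaw ν

/-- The number of items that stay at a node with cardinality `n`. -/
def kept (s s₀ n : ℕ) : ℕ := if s < n then s₀ else n

section Tree

variable {b : ℕ} (s s₀ s₁ : ℕ)

theorem measurable_childSize (n : ℕ) (i : Fin b) :
    Measurable fun D : NodeData b => childSize s s₀ s₁ n D i := by
  unfold childSize
  by_cases h : s < n
  · simp only [h, if_true]
    exact measurable_const.add (measurable_count _ i)
  · simp [h]

theorem size_cons (n : ℕ) (ω : Node b → NodeData b) (i : Fin b) (u : Node b) :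
    size s s₀ s₁ n ω (i :: u) = childSize s s₀ s₁ (size s s₀ s₁ n ω u) (ω u) i := rfl

theorem stored_eq (n : ℕ) (ω : Node b → NodeData b) (u : Node b) :
    stored s s₀ s₁ n ω u = kept s s₀ (size s s₀ s₁ n ω u) := rfl

theorem measurable_size (n : ℕ) (u : Node b) :
    Measurable fun ω : Node b → NodeData b => size s s₀ s₁ n ω u := by
  induction u with
  | nil => exact measurable_const
  | cons i u ih =>
    simp only [size_cons]
    have h1 : Measurable fun z : ℕ × NodeData b => childSize s s₀ s₁ z.1 z.2 i :=
      measurable_from_prod_countable_right fun k => measurable_childSize s s₀ s₁ k i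
    exact h1.comp (ih.prodMk (measurable_pi_apply u))

/-- The cardinality at `u` depends only on the randomness at the proper ancestors of `u`. -/
theorem dependsOn_size (n : ℕ) (u : Node b) :
    DependsOn (fun ω : Node b → NodeData b => size s s₀ s₁ n ω u)
      (u.tails.toFinset.erase u : Finset (Node b)) := by
  induction u with
  | nil => intro ω ω' _; rfl
  | cons i u ih =>
    have hmem : ∀ w ∈ u.tails, w ∈ (i :: u).tails.toFinset.erase (i :: u) := by
      intro w hw
      rw [List.mem_tails] at hw
      have hlen := hw.length_le
      rw [Finset.mem_erase, List.mem_toFinset, List.mem_tails]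
      refine ⟨fun h => ?_, hw.trans (List.suffix_cons i u)⟩
      rw [h, List.length_cons] at hlen
      omega
    intro ω ω' h
    simp only [size_cons]
    have h1 : size s s₀ s₁ n ω u = size s s₀ s₁ n ω' u := ih fun w hw => h w <| by
      rw [Finset.mem_coe, Finset.mem_erase, List.mem_toFinset] at hw
      exact hmem w hw.2
    rw [h1, h u (hmem u (by rw [List.mem_tails]))]

variable (ν : Measure (Fin b → ℝ)) [IsProbabilityMeasure ν]

/-- The branching property: the randomness at `u` is independent of the cardinality at `u`. -/
theorem sum_lintegral_size_cons (n : ℕ) (u : Node b) (φ : ℕ → ℝ≥0∞) :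
    ∑ i, ∫⁻ ω, φ (size s s₀ s₁ n ω (i :: u)) ∂law ν =
      ∫⁻ ω, branchOp ν s s₀ s₁ φ (size s s₀ s₁ n ω u) ∂law ν := by
  have h : ∀ i, ∫⁻ ω, φ (size s s₀ s₁ n ω (i :: u)) ∂law ν =
      ∫⁻ ω, ∫⁻ D, φ (childSize s s₀ s₁ (size s s₀ s₁ n ω u) D i) ∂nodeLaw ν ∂law ν := fun i =>
    lintegral_infinitePi_of_dependsOn (fun _ : Node b => nodeLaw ν) (j := u) (by simp)
      (measurable_size s s₀ s₁ n u) (dependsOn_size s s₀ s₁ n u)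
      (F := fun k D => φ (childSize s s₀ s₁ k D i))
      (measurable_from_prod_countable_right fun k =>
        (measurable_of_countable φ).comp (measurable_childSize s s₀ s₁ k i))
  simp only [h, branchOp]
  rw [lintegral_finsetSum]
  intro i _
  exact (measurable_of_countable fun k => ∫⁻ D, φ (childSize s s₀ s₁ k D i) ∂nodeLaw ν).comp
    (measurable_size s s₀ s₁ n u)

/-- The expected sum of `φ` over the cardinalities of the nodes at depth `k` is `(T^k φ)(n)`. -/
theorem tsum_level_eq_iterate (n k : ℕ) (φ : ℕ → ℝ≥0∞) :
    (∑' u : Node b, if u.length = k then ∫⁻ ω, φ (size s s₀ s₁ n ω u) ∂law ν else 0) =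
      (branchOp ν s s₀ s₁)^[k] φ n := by
  have hprob : IsProbabilityMeasure (law ν) := by unfold law; infer_instance
  induction k generalizing φ with
  | zero =>
    rw [tsum_eq_single []]
    · simp [size]
    · intro u hu
      simp [hu]
  | succ k ih =>
    rw [Function.iterate_succ_apply, ← ih]
    have hinj : Function.Injective fun p : Node b × Fin b => p.2 :: p.1 := by
      rintro ⟨u, i⟩ ⟨w, j⟩ h
      simp only [List.cons.injEq] at h
      simp [h]
    rw [← hinj.tsum_eq]
    · rw [ENNReal.summable.tsum_prod' fun _ => ENNReal.summable]
      refine tsum_congr fun u => ?_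
      rw [tsum_fintype]
      simp only [List.length_cons, Nat.add_right_cancel_iff]
      split_ifs
      · exact sum_lintegral_size_cons s s₀ s₁ ν n u φ
      · simp
    · intro u hu
      cases u with
      | nil => simp at hu
      | cons i u => exact ⟨(u, i), rfl⟩

/-- The expected path length sums, over the levels `k`, `k` times the expected number of items stored
at depth `k`. -/
theorem expectedPathLength_eq_tsum (n : ℕ) :
    expectedPathLength ν s s₀ s₁ n =
      ∑' k : ℕ, (k : ℝ≥0∞) * (branchOp ν s s₀ s₁)^[k] (fun m => (kept s s₀ m : ℝ≥0∞)) n := by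
  set φ : ℕ → ℝ≥0∞ := fun m => (kept s s₀ m : ℝ≥0∞) with hφ
  have hm : ∀ u : Node b, Measurable fun ω => φ (size s s₀ s₁ n ω u) := fun u =>
    (measurable_of_countable φ).comp (measurable_size s s₀ s₁ n u)
  simp only [expectedPathLength, pathLength, stored_eq]
  rw [lintegral_tsum fun u => ((hm u).const_mul _).aemeasurable]
  calc ∑' u : Node b, ∫⁻ ω, (u.length : ℝ≥0∞) * φ (size s s₀ s₁ n ω u) ∂law ν
      = ∑' u : Node b, ∑' k : ℕ, (k : ℝ≥0∞) *
          (if u.length = k then ∫⁻ ω, φ (size s s₀ s₁ n ω u) ∂law ν else 0) := by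
        refine tsum_congr fun u => ?_
        rw [lintegral_const_mul _ (hm u), tsum_eq_single u.length]
        · simp
        · intro k hk
          simp [hk.symm]
    _ = _ := by
        rw [ENNReal.tsum_comm]
        refine tsum_congr fun k => ?_
        rw [ENNReal.tsum_mul_left, tsum_level_eq_iterate]

end Tree

end SplitTree

/-! ### Finiteness and the distributional recursion -/

namespace SplitTree

open ProbabilityTheory Topology

section BranchOp

variable {b : ℕ} (ν : Measure (Fin b → ℝ)) (s s₀ s₁ : ℕ)

theorem branchOp_mono {φ ψ : ℕ → ℝ≥0∞} (h : ∀ m, φ m ≤ ψ m) (n : ℕ) :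
    branchOp ν s s₀ s₁ φ n ≤ branchOp ν s s₀ s₁ ψ n :=
  Finset.sum_le_sum fun _ _ => lintegral_mono fun _ => h _

theorem measurable_comp_childSize (φ : ℕ → ℝ≥0∞) (n : ℕ) (i : Fin b) :
    Measurable fun D : NodeData b => φ (childSize s s₀ s₁ n D i) :=
  (measurable_of_countable φ).comp (measurable_childSize s s₀ s₁ n i)

theorem branchOp_add (φ ψ : ℕ → ℝ≥0∞) (n : ℕ) :
    branchOp ν s s₀ s₁ (fun m => φ m + ψ m) n =
      branchOp ν s s₀ s₁ φ n + branchOp ν s s₀ s₁ ψ n := by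
  simp only [branchOp]
  rw [← Finset.sum_add_distrib]
  exact Finset.sum_congr rfl fun i _ =>
    lintegral_add_left (measurable_comp_childSize s s₀ s₁ φ n i) _

theorem branchOp_const_mul (c : ℝ≥0∞) (φ : ℕ → ℝ≥0∞) (n : ℕ) :
    branchOp ν s s₀ s₁ (fun m => c * φ m) n = c * branchOp ν s s₀ s₁ φ n := by
  simp only [branchOp]
  rw [Finset.mul_sum]
  exact Finset.sum_congr rfl fun i _ =>
    lintegral_const_mul _ (measurable_comp_childSize s s₀ s₁ φ n i)

theorem branchOp_finsetSum (K : ℕ) (φ : ℕ → ℕ → ℝ≥0∞) (n : ℕ) :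
    branchOp ν s s₀ s₁ (fun m => ∑ k ∈ Finset.range K, φ k m) n =
      ∑ k ∈ Finset.range K, branchOp ν s s₀ s₁ (φ k) n := by
  induction K with
  | zero => simp [branchOp]
  | succ K ih => simp only [Finset.sum_range_succ, branchOp_add, ih]

theorem branchOp_tsum (φ : ℕ → ℕ → ℝ≥0∞) (n : ℕ) :
    branchOp ν s s₀ s₁ (fun m => ∑' k, φ k m) n = ∑' k, branchOp ν s s₀ s₁ (φ k) n := by
  simp only [branchOp]
  rw [Summable.tsum_finsetSum fun _ _ => ENNReal.summable]
  exact Finset.sum_congr rfl fun i _ =>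
    lintegral_tsum fun k => (measurable_comp_childSize s s₀ s₁ (φ k) n i).aemeasurable

theorem iterate_branchOp_add (K : ℕ) (φ ψ : ℕ → ℝ≥0∞) (n : ℕ) :
    (branchOp ν s s₀ s₁)^[K] (fun m => φ m + ψ m) n =
      (branchOp ν s s₀ s₁)^[K] φ n + (branchOp ν s s₀ s₁)^[K] ψ n := by
  induction K generalizing φ ψ with
  | zero => rfl
  | succ K ih =>
    rw [Function.iterate_succ_apply, Function.iterate_succ_apply, Function.iterate_succ_apply, ← ih]
    exact congrArg (fun χ => (branchOp ν s s₀ s₁)^[K] χ n)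
      (funext fun m => branchOp_add ν s s₀ s₁ φ ψ m)

variable {s}

theorem branchOp_of_le [IsProbabilityMeasure ν] {n : ℕ} (hn : n ≤ s) (φ : ℕ → ℝ≥0∞) :
    branchOp ν s s₀ s₁ φ n = b * φ 0 := by
  simp [branchOp, childSize, not_lt.2 hn]

end BranchOp

/-- The standing assumptions on the parameters and on the law of the split vectors. -/
structure Admissible {b : ℕ} (ν : Measure (Fin b → ℝ)) (s s₀ s₁ : ℕ) : Prop where
  param : s₀ + b * s₁ ≤ s + 1
  store : 0 < s ∨ 0 < s₀
  simplex : ∀ᵐ v ∂ν, (∀ i, 0 ≤ v i) ∧ ∑ i, v i = 1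
  split : ν {v | ∃ i, v i = 1} < 1

theorem ofReal_add_ofReal_one_sub {p : ℝ} (hp : p ∈ Icc (0 : ℝ) 1) :
    ENNReal.ofReal p + ENNReal.ofReal (1 - p) = 1 := by
  rw [← ENNReal.ofReal_add hp.1 (by linarith [hp.2])]
  simp

namespace Admissible

variable {b : ℕ} {ν : Measure (Fin b → ℝ)} {s s₀ s₁ : ℕ}

theorem mem_unit (h : Admissible ν s s₀ s₁) : ∀ᵐ v ∂ν, ∀ i, v i ∈ Icc (0 : ℝ) 1 := by
  filter_upwards [h.simplex] with v hv i
  refine ⟨hv.1 i, ?_⟩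
  rw [← hv.2]
  exact Finset.single_le_sum (fun k _ => hv.1 k) (Finset.mem_univ i)

theorem lintegral_childSize (h : Admissible ν s s₀ s₁) {n : ℕ} (hn : s < n) (φ : ℕ → ℝ≥0∞)
    (i : Fin b) :
    ∫⁻ D, φ (childSize s s₀ s₁ n D i) ∂nodeLaw ν =
      ∫⁻ v, binomialMean (ENNReal.ofReal (v i)) (ENNReal.ofReal (1 - v i)) (n - s₀ - b * s₁)
        (fun j => φ (s₁ + j)) ∂ν := by
  rw [lintegral_prod _ (measurable_comp_childSize s s₀ s₁ φ n i).aemeasurable]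
  refine lintegral_congr_ae ?_
  filter_upwards [h.simplex] with v hv
  simp only [childSize, if_pos hn]
  exact lintegral_count hv.1 hv.2 i _ fun j => φ (s₁ + j)

variable [IsProbabilityMeasure ν]

theorem not_ae_one (h : Admissible ν s s₀ s₁) : ¬ ∀ᵐ v ∂ν, ∃ i, v i = 1 := fun h1 => by
  have h2 : ν {v | ∃ i, v i = 1} = 1 := by
    rw [← measure_univ (μ := ν)]
    exact measure_congr (h1.mono fun v hv => propext ⟨fun _ => trivial, fun _ => hv⟩)
  exact absurd h.split (by rw [h2]; exact lt_irrefl _)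

theorem two_le (h : Admissible ν s s₀ s₁) : 2 ≤ b := by
  by_contra! hb
  apply h.not_ae_one
  filter_upwards [h.simplex] with v hv
  interval_cases b
  · simp at hv
  · exact ⟨0, by simpa using hv.2⟩

/-- Functions below the identity have a strictly subcritical total mass, because splits are not
almost surely trivial. -/
theorem integral_sum_lt_one (h : Admissible ν s s₀ s₁) {φ : ℝ → ℝ} (hφ : Measurable φ)
    (h0 : ∀ x ∈ Icc (0 : ℝ) 1, 0 ≤ φ x) (h1 : ∀ x ∈ Icc (0 : ℝ) 1, φ x ≤ x)
    (hlt : ∀ x ∈ Ioo (0 : ℝ) 1, φ x < x) :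
    Integrable (fun v => ∑ i, φ (v i)) ν ∧ ∫ v, ∑ i, φ (v i) ∂ν < 1 := by
  have hm : Measurable fun v : Fin b → ℝ => ∑ i, φ (v i) :=
    Finset.measurable_sum _ fun i _ => hφ.comp (measurable_pi_apply i)
  have hle : ∀ᵐ v ∂ν, ∑ i, φ (v i) ≤ 1 := by
    filter_upwards [h.simplex, h.mem_unit] with v hv hv1
    rw [← hv.2]
    exact Finset.sum_le_sum fun i _ => h1 _ (hv1 i)
  have hint : Integrable (fun v => ∑ i, φ (v i)) ν := by
    refine Integrable.of_bound (C := 1) hm.aestronglyMeasurable ?_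
    filter_upwards [hle, h.mem_unit] with v hv hv1
    rwa [Real.norm_eq_abs, abs_of_nonneg (Finset.sum_nonneg fun i _ => h0 _ (hv1 i))]
  refine ⟨hint, ?_⟩
  by_contra! hge
  have hnn : 0 ≤ᵐ[ν] fun v => 1 - ∑ i, φ (v i) := by
    filter_upwards [hle] with v hv
    exact sub_nonneg.2 hv
  have hz : ∫ v, (1 - ∑ i, φ (v i)) ∂ν = 0 := by
    refine le_antisymm ?_ (integral_nonneg_of_ae hnn)
    rw [integral_sub (integrable_const _) hint]
    simpa using hge
  rw [integral_eq_zero_iff_of_nonneg_ae hnn ((integrable_const _).sub hint)] at hz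
  apply h.not_ae_one
  filter_upwards [hz, h.simplex, h.mem_unit] with v hv hv1 hv2
  simp only [Pi.zero_apply] at hv
  have h3 : ∀ i, v i = φ (v i) := by
    have h4 : ∑ i, (v i - φ (v i)) = 0 := by rw [Finset.sum_sub_distrib, hv1.2]; exact hv
    intro i
    have := (Finset.sum_eq_zero_iff_of_nonneg fun i _ => sub_nonneg.2 (h1 _ (hv2 i))).1 h4 i
      (Finset.mem_univ i)
    linarith
  by_contra! hne
  have h5 : ∀ i, v i = 0 := by
    intro i
    by_contra h0
    have := hlt (v i) ⟨lt_of_le_of_ne (hv2 i).1 (Ne.symm h0), lt_of_le_of_ne (hv2 i).2 (hne i)⟩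
    linarith [h3 i]
  have := hv1.2
  simp [h5] at this

theorem childSize_le (h : Admissible ν s s₀ s₁) (n : ℕ) (D : NodeData b) (i : Fin b) :
    childSize s s₀ s₁ n D i ≤ n := by
  unfold childSize
  split_ifs with hn
  · have h1 := count_le D (n - s₀ - b * s₁) i
    have h2 := h.param
    have h3 : s₁ ≤ b * s₁ := Nat.le_mul_of_pos_left _ (by have := h.two_le; omega)
    omega
  · exact Nat.zero_le _

theorem childSize_lt (h : Admissible ν s s₀ s₁) {n : ℕ} (hn : s < n) (hs : s₀ ≠ 0 ∨ s₁ ≠ 0)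
    (D : NodeData b) (i : Fin b) : childSize s s₀ s₁ n D i < n := by
  unfold childSize
  rw [if_pos hn]
  have h1 := count_le D (n - s₀ - b * s₁) i
  have h2 := h.param
  have h3 : 2 * s₁ ≤ b * s₁ := Nat.mul_le_mul_right _ h.two_le
  omega

/-- Conservation of items: those of a node are kept there or passed on to its children. -/
theorem branchOp_natCast_add_kept (h : Admissible ν s s₀ s₁) (n : ℕ) :
    branchOp ν s s₀ s₁ (fun m => (m : ℝ≥0∞)) n + (kept s s₀ n : ℝ≥0∞) = n := by
  rcases le_or_gt n s with hn | hn
  · simp [branchOp_of_le ν s₀ s₁ hn, kept, not_lt.2 hn]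
  · have h1 : ∀ i : Fin b, ∫⁻ D, ((childSize s s₀ s₁ n D i : ℕ) : ℝ≥0∞) ∂nodeLaw ν =
        s₁ + (n - s₀ - b * s₁ : ℕ) * ∫⁻ v, ENNReal.ofReal (v i) ∂ν := by
      intro i
      rw [h.lintegral_childSize hn (fun m => (m : ℝ≥0∞)) i,
        ← lintegral_const_mul _ (by fun_prop)]
      have h2 : ∫⁻ _ : Fin b → ℝ, (s₁ : ℝ≥0∞) ∂ν = s₁ := by simp
      conv_rhs => rw [← h2]
      rw [← lintegral_add_left measurable_const]
      refine lintegral_congr_ae ?_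
      filter_upwards [h.mem_unit] with v hv
      have hpq := ofReal_add_ofReal_one_sub (hv i)
      simp only [Nat.cast_add, binomialMean_add, binomialMean_const hpq, binomialMean_natCast hpq]
    have h3 : ∑ i, ∫⁻ v, ENNReal.ofReal (v i) ∂ν = 1 := by
      rw [← lintegral_finsetSum _ fun i _ => by fun_prop]
      rw [lintegral_congr_ae (g := fun _ => 1)]
      · simp
      · filter_upwards [h.simplex] with v hv
        rw [← ENNReal.ofReal_sum_of_nonneg fun i _ => hv.1 i, hv.2, ENNReal.ofReal_one]
    simp only [branchOp, h1]
    rw [Finset.sum_add_distrib, ← Finset.mul_sum, h3, Finset.sum_const, Finset.card_univ,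
      Fintype.card_fin, nsmul_eq_mul, mul_one, kept, if_pos hn]
    have := h.param
    norm_cast
    omega

/-- A node with more than `s` items passes all of them to a single child with probability less than
one. -/
theorem branchOp_indicator_lt_one (h : Admissible ν s s₀ s₁) {n : ℕ} (hn : s < n) :
    branchOp ν s s₀ s₁ (fun m => if m = n then 1 else 0) n < 1 := by
  by_cases hs : s₀ ≠ 0 ∨ s₁ ≠ 0
  · have h1 : ∀ D i, (if childSize s s₀ s₁ n D i = n then (1 : ℝ≥0∞) else 0) = 0 := fun D i =>
      if_neg (h.childSize_lt hn hs D i).ne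
    simp [branchOp, h1]
  · push Not at hs
    obtain ⟨rfl, rfl⟩ := hs
    have hn2 : 2 ≤ n := by have := h.store; omega
    simp only [branchOp, h.lintegral_childSize hn fun m => if m = n then (1 : ℝ≥0∞) else 0]
    simp only [mul_zero, tsub_zero, zero_add, binomialMean_top]
    rw [← lintegral_finsetSum _ fun i _ => by fun_prop]
    obtain ⟨hi, hlt⟩ := h.integral_sum_lt_one (φ := fun x => x ^ n) (by fun_prop)
      (fun x hx => pow_nonneg hx.1 _)
      (fun x hx => pow_le_of_le_one hx.1 hx.2 (by omega))
      (fun x hx => pow_lt_self_of_lt_one₀ hx.1 hx.2 (by omega))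
    have h2 : ∫⁻ v, ∑ i, ENNReal.ofReal (v i) ^ n ∂ν = ∫⁻ v, ENNReal.ofReal (∑ i, v i ^ n) ∂ν := by
      refine lintegral_congr_ae ?_
      filter_upwards [h.simplex] with v hv
      rw [ENNReal.ofReal_sum_of_nonneg fun i _ => pow_nonneg (hv.1 i) _]
      exact Finset.sum_congr rfl fun i _ => (ENNReal.ofReal_pow (hv.1 i) n).symm
    rw [h2, ← ofReal_integral_eq_lintegral_ofReal hi]
    · rw [← ENNReal.ofReal_one]
      exact (ENNReal.ofReal_lt_ofReal_iff one_pos).2 hlt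
    · filter_upwards [h.simplex] with v hv
      exact Finset.sum_nonneg fun i _ => pow_nonneg (hv.1 i) _

/-- Iterates of the branching operator with source at most `n` stay bounded. As children are not
larger than their parent, this follows by strong induction on `n`, where the feedback from a child
of cardinality `n` has a coefficient less than one. -/
theorem exists_bound_of_le_branchOp (h : Admissible ν s s₀ s₁) {a : ℕ → ℕ → ℝ≥0∞}
    (ha0 : ∀ n, a 0 n = 0) (ha : ∀ K n, a (K + 1) n ≤ branchOp ν s s₀ s₁ (a K) n + n) (n : ℕ) :
    ∃ Z : ℝ≥0∞, Z ≠ ∞ ∧ ∀ K, a K n ≤ Z := by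
  have hzero : ∀ K, a K 0 = 0 := by
    intro K
    induction K with
    | zero => exact ha0 0
    | succ K ih =>
      have := ha K 0
      rw [branchOp_of_le ν s₀ s₁ (Nat.zero_le s), ih] at this
      simpa using this
  induction n using Nat.strong_induction_on with
  | _ n ih =>
    rcases le_or_gt n s with hn | hn
    · refine ⟨n, ENNReal.natCast_ne_top n, fun K => ?_⟩
      cases K with
      | zero => simp [ha0]
      | succ K =>
        have := ha K n
        rw [branchOp_of_le ν s₀ s₁ hn, hzero] at this
        simpa using this
    · choose! Z hZ hZa using ih
      -- The bound `Y` solves `Y = b S + n + q Y`, where `q < 1` is the feedback coefficient.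
      set S := ∑ m ∈ Finset.range n, Z m with hS
      have hSt : S ≠ ∞ := ENNReal.sum_ne_top.2 fun m hm => hZ m (Finset.mem_range.1 hm)
      set q := branchOp ν s s₀ s₁ (fun m => if m = n then 1 else 0) n with hq
      have hq1 : q < 1 := h.branchOp_indicator_lt_one hn
      have hq2 : 1 - q ≠ 0 := (tsub_pos_of_lt hq1).ne'
      have hq3 : 1 - q ≠ ∞ := ENNReal.sub_ne_top ENNReal.one_ne_top
      set A := b * S + n with hA
      have hAt : A ≠ ∞ := ENNReal.add_ne_top.2
        ⟨ENNReal.mul_ne_top (ENNReal.natCast_ne_top b) hSt, ENNReal.natCast_ne_top n⟩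
      set Y := A / (1 - q) with hY
      have hfix : A + Y * q = Y := by
        have h1 : Y * (1 - q) = A := ENNReal.div_mul_cancel hq2 hq3
        rw [← h1, ← mul_add, tsub_add_cancel_of_le hq1.le, mul_one]
      refine ⟨Y, (ENNReal.div_lt_top hAt hq2).ne, fun K => ?_⟩
      induction K with
      | zero => simp [ha0]
      | succ K ihK =>
        have h1 : branchOp ν s s₀ s₁ (a K) n ≤ b * S + Y * q := by
          have h2 : ∀ (D : NodeData b) (i : Fin b), a K (childSize s s₀ s₁ n D i) ≤
              S + Y * (if childSize s s₀ s₁ n D i = n then 1 else 0) := by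
            intro D i
            rcases (h.childSize_le n D i).lt_or_eq with hlt | heq
            · refine (hZa _ hlt K).trans (le_trans ?_ (self_le_add_right _ _))
              exact Finset.single_le_sum (f := Z) (fun _ _ => zero_le)
                (Finset.mem_range.2 hlt)
            · rw [heq, if_pos rfl, mul_one]
              exact ihK.trans (self_le_add_left _ _)
          calc branchOp ν s s₀ s₁ (a K) n
              ≤ ∑ i, ∫⁻ D, (S + Y * (if childSize s s₀ s₁ n D i = n then 1 else 0)) ∂nodeLaw ν :=
                Finset.sum_le_sum fun i _ => lintegral_mono fun D => h2 D i
            _ = b * S + Y * q := by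
                rw [hq, ← branchOp_const_mul, branchOp]
                have h3 : (b : ℝ≥0∞) * S = ∑ _i : Fin b, S := by simp
                rw [h3, ← Finset.sum_add_distrib]
                refine Finset.sum_congr rfl fun i _ => ?_
                rw [lintegral_add_left measurable_const]
                simp
        calc a (K + 1) n ≤ branchOp ν s s₀ s₁ (a K) n + n := ha K n
          _ ≤ b * S + Y * q + n := by gcongr
          _ = A + Y * q := by rw [hA]; ring
          _ = Y := hfix

/-- Conservation of items over `K` levels: an item is stored above depth `K` or lies in the subtree
of a node at depth `K`. -/
theorem natCast_eq_sum_add_iterate (h : Admissible ν s s₀ s₁) (n K : ℕ) :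
    (n : ℝ≥0∞) = ∑ k ∈ Finset.range K,
      (branchOp ν s s₀ s₁)^[k] (fun m => (kept s s₀ m : ℝ≥0∞)) n +
      (branchOp ν s s₀ s₁)^[K] (fun m => (m : ℝ≥0∞)) n := by
  induction K with
  | zero => simp
  | succ K ih =>
    have h1 : (fun m : ℕ => (m : ℝ≥0∞)) = fun m =>
        (kept s s₀ m : ℝ≥0∞) + branchOp ν s s₀ s₁ (fun m => (m : ℝ≥0∞)) m :=
      funext fun m => by rw [add_comm, h.branchOp_natCast_add_kept]
    conv_lhs => rw [ih]
    rw [Finset.sum_range_succ, Function.iterate_succ_apply, add_assoc]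
    congr 1
    conv_lhs => rw [h1]
    exact iterate_branchOp_add ν s s₀ s₁ K _ _ n

/-- Every item is stored somewhere. -/
theorem tsum_iterate_kept (h : Admissible ν s s₀ s₁) (n : ℕ) :
    ∑' k, (branchOp ν s s₀ s₁)^[k] (fun m => (kept s s₀ m : ℝ≥0∞)) n = n := by
  obtain ⟨Z, hZ, hZb⟩ := h.exists_bound_of_le_branchOp
    (a := fun K n => ∑ k ∈ Finset.range K, (branchOp ν s s₀ s₁)^[k] (fun m => (m : ℝ≥0∞)) n)
    (by simp) (fun K n => by
      rw [Finset.sum_range_succ', branchOp_finsetSum]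
      simp only [Function.iterate_succ_apply', Function.iterate_zero, id]
      exact le_rfl) n
  have h1 : Tendsto (fun K => (branchOp ν s s₀ s₁)^[K] (fun m => (m : ℝ≥0∞)) n) atTop (𝓝 0) :=
    ENNReal.tendsto_atTop_zero_of_tsum_ne_top
      (ne_top_of_le_ne_top hZ (ENNReal.tsum_le_of_sum_range_le hZb))
  have h2 := (ENNReal.summable.hasSum (f := fun k =>
    (branchOp ν s s₀ s₁)^[k] (fun m => (kept s s₀ m : ℝ≥0∞)) n)).tendsto_sum_nat.add h1
  simp only [← h.natCast_eq_sum_add_iterate n, add_zero] at h2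
  exact tendsto_nhds_unique h2 tendsto_const_nhds |>.symm ▸ rfl

/-- The partial sums over levels satisfy the inequality of `exists_bound_of_le_branchOp`, because the
expected number of items stored below a node is at most its cardinality. -/
theorem expectedPathLength_ne_top (h : Admissible ν s s₀ s₁) (n : ℕ) :
    expectedPathLength ν s s₀ s₁ n ≠ ∞ := by
  set κ : ℕ → ℝ≥0∞ := fun m => (kept s s₀ m : ℝ≥0∞) with hκ
  obtain ⟨Z, hZ, hZb⟩ := h.exists_bound_of_le_branchOp
    (a := fun K n => ∑ k ∈ Finset.range K, (k : ℝ≥0∞) * (branchOp ν s s₀ s₁)^[k] κ n)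
    (by simp) (fun K n => by
      have h1 : ∑ k ∈ Finset.range (K + 1), (k : ℝ≥0∞) * (branchOp ν s s₀ s₁)^[k] κ n =
          branchOp ν s s₀ s₁ (fun m =>
            (∑ k ∈ Finset.range K, (k : ℝ≥0∞) * (branchOp ν s s₀ s₁)^[k] κ m) +
              ∑ k ∈ Finset.range K, (branchOp ν s s₀ s₁)^[k] κ m) n := by
        rw [Finset.sum_range_succ', branchOp_add, branchOp_finsetSum, branchOp_finsetSum,
          ← Finset.sum_add_distrib]
        simp only [Nat.cast_zero, zero_mul, add_zero, branchOp_const_mul,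
          Function.iterate_succ_apply', Nat.cast_add, Nat.cast_one, add_mul, one_mul]
      rw [h1, branchOp_add]
      gcongr
      calc branchOp ν s s₀ s₁ (fun m => ∑ k ∈ Finset.range K, (branchOp ν s s₀ s₁)^[k] κ m) n
          ≤ branchOp ν s s₀ s₁ (fun m => (m : ℝ≥0∞)) n := by
            refine branchOp_mono ν s s₀ s₁ (fun m => ?_) n
            rw [h.natCast_eq_sum_add_iterate m K]
            exact self_le_add_right _ _
        _ ≤ n := by
            rw [← h.branchOp_natCast_add_kept n]
            exact self_le_add_right _ _) n
  rw [expectedPathLength_eq_tsum]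
  exact ne_top_of_le_ne_top hZ (ENNReal.tsum_le_of_sum_range_le hZb)

/-- The distributional recursion for the expected path length: each item below the root contributes
one more than in its subtree. -/
theorem expectedPathLength_eq (h : Admissible ν s s₀ s₁) (n : ℕ) :
    expectedPathLength ν s s₀ s₁ n =
      branchOp ν s s₀ s₁ (fun m => expectedPathLength ν s s₀ s₁ m) n +
        branchOp ν s s₀ s₁ (fun m => (m : ℝ≥0∞)) n := by
  set κ : ℕ → ℝ≥0∞ := fun m => (kept s s₀ m : ℝ≥0∞) with hκ
  rw [expectedPathLength_eq_tsum, tsum_eq_zero_add' ENNReal.summable]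
  simp only [Nat.cast_zero, zero_mul, zero_add, Function.iterate_succ_apply', Nat.cast_add,
    Nat.cast_one]
  simp only [← branchOp_const_mul, ← branchOp_tsum]
  rw [← branchOp_add]
  congr 1
  funext m
  rw [expectedPathLength_eq_tsum, ← h.tsum_iterate_kept m, ← ENNReal.tsum_add]
  refine tsum_congr fun k => ?_
  rw [add_mul, one_mul]

theorem expectedPathLength_of_le (h : Admissible ν s s₀ s₁) {n : ℕ} (hn : n ≤ s) :
    expectedPathLength ν s s₀ s₁ n = 0 := by
  have h0 : expectedPathLength ν s s₀ s₁ 0 = 0 := by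
    have h1 := h.expectedPathLength_eq 0
    rw [branchOp_of_le ν s₀ s₁ (Nat.zero_le s), branchOp_of_le ν s₀ s₁ (Nat.zero_le s)] at h1
    simp only [Nat.cast_zero, mul_zero, add_zero] at h1
    have hb := h.two_le
    have hfin := h.expectedPathLength_ne_top 0
    set x := expectedPathLength ν s s₀ s₁ 0
    by_contra hx
    have h2 : (1 : ℝ≥0∞) * x < b * x := by
      refine (ENNReal.mul_lt_mul_iff_left hx hfin).2 ?_
      exact_mod_cast hb
    rw [one_mul, ← h1] at h2
    exact lt_irrefl _ h2
  rw [h.expectedPathLength_eq, branchOp_of_le ν s₀ s₁ hn, branchOp_of_le ν s₀ s₁ hn, h0]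
  simp

end Admissible

end SplitTree

/-! ### Growth of the increments of the expected path length -/

namespace SplitTree

open ProbabilityTheory Topology

section RealBinomialMean

theorem continuous_binomialMean (m : ℕ) (φ : ℕ → ℝ) :
    Continuous fun p : ℝ => binomialMean p (1 - p) m φ := by
  induction m generalizing φ with
  | zero => exact continuous_const
  | succ m ih =>
    have h1 := ih φ
    have h2 := ih fun j => φ (j + 1)
    simp only [binomialMean]
    fun_prop

theorem binomialMean_sub (p q : ℝ) (m : ℕ) (φ ψ : ℕ → ℝ) :
    binomialMean p q m (fun j => φ j - ψ j) = binomialMean p q m φ - binomialMean p q m ψ := by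
  have h := binomialMean_add p q m (fun j => φ j - ψ j) ψ
  simp only [sub_add_cancel] at h
  linarith

theorem binomialMean_mono {p q : ℝ} (hp : 0 ≤ p) (hq : 0 ≤ q) {m : ℕ} {φ ψ : ℕ → ℝ}
    (h : ∀ j ≤ m, φ j ≤ ψ j) : binomialMean p q m φ ≤ binomialMean p q m ψ := by
  induction m generalizing φ ψ with
  | zero => exact h 0 le_rfl
  | succ m ih =>
    rw [binomialMean, binomialMean]
    have h1 := ih (φ := φ) (ψ := ψ) fun j hj => h j (by omega)
    have h2 := ih (φ := fun j => φ (j + 1)) (ψ := fun j => ψ (j + 1)) fun j hj => h (j + 1)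
      (by omega)
    gcongr

/-- Adding one trial changes the mean by `p` times the mean of the forward difference. -/
theorem binomialMean_succ_sub {p q : ℝ} (hpq : p + q = 1) (m : ℕ) (φ : ℕ → ℝ) :
    binomialMean p q (m + 1) φ - binomialMean p q m φ =
      p * binomialMean p q m (fun j => φ (j + 1) - φ j) := by
  rw [binomialMean_sub, binomialMean, show q = 1 - p by linarith]
  ring

theorem abs_binomialMean_le {p q : ℝ} (hp : 0 ≤ p) (hq : 0 ≤ q) (m : ℕ) (φ : ℕ → ℝ) :
    |binomialMean p q m φ| ≤ binomialMean p q m fun j => |φ j| := by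
  have h := binomialMean_mono hp hq (m := m) (φ := fun j => -1 * |φ j|) (ψ := φ)
    fun j _ => by linarith [neg_abs_le (φ j)]
  rw [binomialMean_const_mul] at h
  exact abs_le.2 ⟨by linarith, binomialMean_mono hp hq fun j _ => le_abs_self _⟩

/-- Jensen's inequality for the binomial distribution. -/
theorem binomialMean_le_of_concaveOn {p : ℝ} (hp : p ∈ Icc (0 : ℝ) 1) {φ : ℝ → ℝ}
    (hφ : ConcaveOn ℝ (Ici 0) φ) (m : ℕ) {c : ℝ} (hc : 0 ≤ c) :
    binomialMean p (1 - p) m (fun j => φ (c + j)) ≤ φ (c + m * p) := by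
  induction m generalizing c with
  | zero => simp [binomialMean]
  | succ m ih =>
    have hp0 := hp.1
    have hp1 := hp.2
    have h1 := ih hc
    have h2 := ih (c := c + 1) (by linarith)
    have hmp : 0 ≤ (m : ℝ) * p := by positivity
    have h3 := hφ.2 (x := c + 1 + m * p) (y := c + m * p) (mem_Ici.2 (by linarith))
      (mem_Ici.2 (by linarith)) hp0 (sub_nonneg.2 hp1) (by ring)
    simp only [smul_eq_mul] at h3
    rw [binomialMean]
    calc p * binomialMean p (1 - p) m (fun j => φ (c + ((j + 1 : ℕ) : ℝ))) +
          (1 - p) * binomialMean p (1 - p) m (fun j => φ (c + j))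
        = p * binomialMean p (1 - p) m (fun j => φ (c + 1 + j)) +
          (1 - p) * binomialMean p (1 - p) m (fun j => φ (c + j)) := by
          congr 3
          funext j
          push_cast
          congr 1
          ring
      _ ≤ p * φ (c + 1 + m * p) + (1 - p) * φ (c + m * p) := by
          have : 0 ≤ 1 - p := sub_nonneg.2 hp1
          gcongr
      _ ≤ φ (c + (m + 1 : ℕ) * p) := by
          refine h3.trans (le_of_eq ?_)
          congr 1
          push_cast
          ring

/-- The second moment about `a`: variance plus squared bias. -/
theorem binomialMean_sq_sub (p : ℝ) (m : ℕ) (a : ℝ) :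
    binomialMean p (1 - p) m (fun j => ((j : ℝ) - a) ^ 2) = m * p * (1 - p) + (m * p - a) ^ 2 := by
  induction m generalizing a with
  | zero => simp [binomialMean]
  | succ m ih =>
    rw [binomialMean, ih a]
    have h1 : (fun j : ℕ => (((j + 1 : ℕ) : ℝ) - a) ^ 2) = fun j : ℕ => ((j : ℝ) - (a - 1)) ^ 2 := by
      funext j; push_cast; ring
    rw [h1, ih (a - 1)]
    push_cast
    ring

theorem binomialMean_abs_sub_le {p : ℝ} (hp : p ∈ Icc (0 : ℝ) 1) {m : ℕ} {t : ℝ} (ht : 0 < t)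
    (hmt : m ≤ t) : binomialMean p (1 - p) m (fun j => |(j : ℝ) - m * p|) ≤ √t := by
  have hp0 := hp.1
  have hp1 := hp.2
  have hs : 0 < √t := Real.sqrt_pos.2 ht
  have hss : √t * √t = t := Real.mul_self_sqrt ht.le
  have h1 : binomialMean p (1 - p) m (fun j => |(j : ℝ) - m * p|) ≤
      binomialMean p (1 - p) m (fun j => (2 * √t)⁻¹ * ((j : ℝ) - m * p) ^ 2 + √t / 2) := by
    refine binomialMean_mono hp0 (sub_nonneg.2 hp1) fun j _ => ?_
    -- `2 |x| ≤ x² / √t + √t`.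
    rw [← sq_abs]
    set x := |(j : ℝ) - m * p|
    have : (2 * √t)⁻¹ * x ^ 2 + √t / 2 - x = (2 * √t)⁻¹ * (x - √t) ^ 2 := by
      field_simp
      ring
    have h2 : 0 ≤ (2 * √t)⁻¹ * (x - √t) ^ 2 := by positivity
    linarith
  rw [binomialMean_add, binomialMean_const_mul, binomialMean_sq_sub,
    binomialMean_const (by ring)] at h1
  have h3 : (m : ℝ) * p * (1 - p) + (m * p - m * p) ^ 2 ≤ t := by
    have h4 : p * (1 - p) ≤ 1 := by nlinarith
    have h5 : (0 : ℝ) ≤ m := Nat.cast_nonneg m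
    nlinarith
  have h4 : (2 * √t)⁻¹ * ((m : ℝ) * p * (1 - p) + (m * p - m * p) ^ 2) ≤ (2 * √t)⁻¹ * t := by
    gcongr
  have h5 : (2 * √t)⁻¹ * t = √t / 2 := by
    field_simp
    nlinarith
  linarith

end RealBinomialMean

/-- The expected path length as a real number. -/
noncomputable def meanPathLength {b : ℕ} (ν : Measure (Fin b → ℝ)) [IsProbabilityMeasure ν]
    (s s₀ s₁ n : ℕ) : ℝ :=
  (expectedPathLength ν s s₀ s₁ n).toReal

/-- The increment `E Ψ(T^(n+1)) - E Ψ(T^n)`. -/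
noncomputable def pathLengthIncrement {b : ℕ} (ν : Measure (Fin b → ℝ)) [IsProbabilityMeasure ν]
    (s s₀ s₁ n : ℕ) : ℝ :=
  meanPathLength ν s s₀ s₁ (n + 1) - meanPathLength ν s s₀ s₁ n

namespace Admissible

variable {b : ℕ} {ν : Measure (Fin b → ℝ)} {s s₀ s₁ : ℕ}

theorem add_le_of_le (h : Admissible ν s s₀ s₁) (i : Fin b) {n j : ℕ} (hn : s < n)
    (hj : j ≤ n - s₀ - b * s₁) : s₁ + j ≤ n := by
  have h2 := h.param
  have h3 : s₁ ≤ b * s₁ := Nat.le_mul_of_pos_left _ i.pos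
  omega

variable [IsProbabilityMeasure ν]

theorem integrable_comp (h : Admissible ν s s₀ s₁) {g : ℝ → ℝ} (hg : Continuous g) (i : Fin b) :
    Integrable (fun v => g (v i)) ν := by
  obtain ⟨M, hM⟩ := (isCompact_Icc (a := (0 : ℝ)) (b := 1)).exists_bound_of_continuousOn
    hg.continuousOn
  refine Integrable.of_bound (C := M)
    (hg.measurable.comp (measurable_pi_apply i)).aestronglyMeasurable ?_
  filter_upwards [h.mem_unit] with v hv
  exact hM _ (hv i)

theorem sum_integral_const_mul (h : Admissible ν s s₀ s₁) (c : ℝ) :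
    ∑ i, ∫ v, v i * c ∂ν = c := by
  rw [← integral_finsetSum _ fun i _ => h.integrable_comp (g := fun x => x * c) (by fun_prop) i]
  rw [integral_congr_ae (g := fun _ => c)]
  · simp
  · filter_upwards [h.simplex] with v hv
    rw [← Finset.sum_mul, hv.2, one_mul]

theorem meanPathLength_nonneg (n : ℕ) : 0 ≤ meanPathLength ν s s₀ s₁ n := ENNReal.toReal_nonneg

theorem meanPathLength_of_le (h : Admissible ν s s₀ s₁) {n : ℕ} (hn : n ≤ s) :
    meanPathLength ν s s₀ s₁ n = 0 := by
  rw [meanPathLength, h.expectedPathLength_of_le hn, ENNReal.toReal_zero]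

theorem meanPathLength_eq (h : Admissible ν s s₀ s₁) {n : ℕ} (hn : s < n) :
    meanPathLength ν s s₀ s₁ n = (n - s₀ : ℝ) + ∑ i, ∫ v, binomialMean (v i) (1 - v i)
      (n - s₀ - b * s₁) (fun j => meanPathLength ν s s₀ s₁ (s₁ + j)) ∂ν := by
  have hpar := h.param
  have h1 : branchOp ν s s₀ s₁ (fun m => (m : ℝ≥0∞)) n = ((n - s₀ : ℕ) : ℝ≥0∞) := by
    have h2 := h.branchOp_natCast_add_kept n
    rw [kept, if_pos hn] at h2
    have h3 : ((n - s₀ : ℕ) : ℝ≥0∞) + s₀ = n := by norm_cast; omega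
    exact (ENNReal.add_left_inj (ENNReal.natCast_ne_top s₀)).1 (h2.trans h3.symm)
  have hfin := h.expectedPathLength_ne_top n
  have h2 := h.expectedPathLength_eq n
  rw [h1] at h2
  rw [h2, branchOp] at hfin
  have hfin2 := (ENNReal.add_ne_top.1 hfin).1
  rw [meanPathLength, h2, branchOp, ENNReal.toReal_add hfin2 (ENNReal.natCast_ne_top _),
    ENNReal.toReal_sum fun i hi => ENNReal.sum_ne_top.1 hfin2 i hi, add_comm,
    ENNReal.toReal_natCast, Nat.cast_sub (by omega)]
  congr 1
  refine Finset.sum_congr rfl fun i _ => ?_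
  rw [h.lintegral_childSize hn, integral_eq_lintegral_of_nonneg_ae]
  · congr 1
    refine lintegral_congr_ae ?_
    filter_upwards [h.mem_unit] with v hv
    rw [← (binomialMean_ofReal (hv i).1 (sub_nonneg.2 (hv i).2) _
      fun j => meanPathLength_nonneg (s₁ + j)).2]
    congr 1
    funext j
    exact (ENNReal.ofReal_toReal (h.expectedPathLength_ne_top _)).symm
  · filter_upwards [h.mem_unit] with v hv
    exact (binomialMean_ofReal (hv i).1 (sub_nonneg.2 (hv i).2) _
      fun j => meanPathLength_nonneg (s₁ + j)).1
  · exact (h.integrable_comp (continuous_binomialMean _ _) i).aestronglyMeasurable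

/-- The path of one additional item follows a size-biased choice of children. -/
theorem pathLengthIncrement_eq (h : Admissible ν s s₀ s₁) {n : ℕ} (hn : s < n) :
    pathLengthIncrement ν s s₀ s₁ n = 1 + ∑ i, ∫ v, v i * binomialMean (v i) (1 - v i)
      (n - s₀ - b * s₁) (fun j => pathLengthIncrement ν s s₀ s₁ (s₁ + j)) ∂ν := by
  have hpar := h.param
  rw [pathLengthIncrement, h.meanPathLength_eq hn, h.meanPathLength_eq (n := n + 1) (by omega),
    show n + 1 - s₀ - b * s₁ = n - s₀ - b * s₁ + 1 by omega, add_sub_add_comm,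
    ← Finset.sum_sub_distrib]
  congr 1
  · push_cast; ring
  · refine Finset.sum_congr rfl fun i _ => ?_
    rw [← integral_sub (h.integrable_comp (continuous_binomialMean _ _) i)
      (h.integrable_comp (continuous_binomialMean _ _) i)]
    refine integral_congr_ae (Eventually.of_forall fun v => ?_)
    simp only
    rw [binomialMean_succ_sub (by ring)]
    rfl

/-- Maximum principle for the size-biased chain of cardinalities: a positive value of `w` at the
first `n` possible can only come from the event that a child has cardinality `n` again, which has
probability less than one. -/
theorem nonpos_of_le_mean (h : Admissible ν s s₀ s₁) {w : ℕ → ℝ} {n₀ : ℕ} (hn₀ : s < n₀)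
    (hlow : ∀ n < n₀, w n ≤ 0)
    (hw : ∀ n ≥ n₀, w n ≤ ∑ i, ∫ v, v i * binomialMean (v i) (1 - v i) (n - s₀ - b * s₁)
      (fun j => w (s₁ + j)) ∂ν) (n : ℕ) : w n ≤ 0 := by
  induction n using Nat.strong_induction_on with
  | _ n ih =>
    rcases lt_or_ge n n₀ with hlt | hge
    · exact hlow n hlt
    have hn : s < n := hn₀.trans_le hge
    by_contra! hpos
    have hpar := h.param
    have hcont : ∀ (φ : ℕ → ℝ) (i : Fin b), Integrable
        (fun v => v i * binomialMean (v i) (1 - v i) (n - s₀ - b * s₁) φ) ν := fun φ i =>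
      h.integrable_comp (g := fun x => x * binomialMean x (1 - x) (n - s₀ - b * s₁) φ)
        (continuous_id.mul (continuous_binomialMean _ _)) i
    by_cases hs : s₀ ≠ 0 ∨ s₁ ≠ 0
    · refine absurd (hw n hge) (not_le.2 (lt_of_le_of_lt ?_ hpos))
      refine Finset.sum_nonpos fun i _ => integral_nonpos_of_ae ?_
      filter_upwards [h.mem_unit] with v hv
      refine mul_nonpos_of_nonneg_of_nonpos (hv i).1 ?_
      refine (binomialMean_mono (ψ := fun _ => 0) (hv i).1 (sub_nonneg.2 (hv i).2)
        fun j hj => ih _ ?_).trans (le_of_eq (binomialMean_const (by ring) _ _))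
      have h3 : 2 * s₁ ≤ b * s₁ := Nat.mul_le_mul_right _ h.two_le
      omega
    · push Not at hs
      obtain ⟨rfl, rfl⟩ := hs
      simp only [mul_zero, tsub_zero, zero_add] at hw hcont
      obtain ⟨hi, hlt⟩ := h.integral_sum_lt_one (φ := fun x => x ^ (n + 1)) (by fun_prop)
        (fun x hx => pow_nonneg hx.1 _)
        (fun x hx => pow_le_of_le_one hx.1 hx.2 (by omega))
        (fun x hx => pow_lt_self_of_lt_one₀ hx.1 hx.2 (by omega))
      have h1 : w n ≤ w n * ∫ v, ∑ i, v i ^ (n + 1) ∂ν := by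
        refine (hw n hge).trans ?_
        rw [integral_finsetSum _ fun i _ => h.integrable_comp (g := fun x => x ^ (n + 1))
          (by fun_prop) i, Finset.mul_sum]
        refine Finset.sum_le_sum fun i _ => ?_
        rw [← integral_const_mul]
        refine integral_mono_ae (hcont _ i) ((h.integrable_comp (g := fun x => x ^ (n + 1))
          (by fun_prop) i).const_mul _) ?_
        filter_upwards [h.mem_unit] with v hv
        have h2 : binomialMean (v i) (1 - v i) n w ≤ w n * v i ^ n := by
          rw [← binomialMean_top (v i) (1 - v i) n, ← binomialMean_const_mul]
          refine binomialMean_mono (hv i).1 (sub_nonneg.2 (hv i).2) fun j hj => ?_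
          rcases hj.lt_or_eq with hjn | rfl
          · rw [if_neg hjn.ne, mul_zero]
            exact ih j hjn
          · simp
        calc v i * binomialMean (v i) (1 - v i) n w ≤ v i * (w n * v i ^ n) :=
              mul_le_mul_of_nonneg_left h2 (hv i).1
          _ = w n * v i ^ (n + 1) := by ring
      nlinarith

theorem pathLengthIncrement_nonneg (h : Admissible ν s s₀ s₁) (n : ℕ) :
    0 ≤ pathLengthIncrement ν s s₀ s₁ n := by
  have := h.nonpos_of_le_mean (w := fun n => -1 * pathLengthIncrement ν s s₀ s₁ n)
    (n₀ := s + 1) (by omega) (fun n hn => by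
      have h1 : 0 ≤ pathLengthIncrement ν s s₀ s₁ n := by
        rw [pathLengthIncrement, h.meanPathLength_of_le (n := n) (by omega), sub_zero]
        exact meanPathLength_nonneg _
      linarith) (fun n hn => by
      simp only [binomialMean_const_mul, mul_left_comm _ (-1 : ℝ), integral_const_mul]
      rw [← Finset.mul_sum, h.pathLengthIncrement_eq (n := n) (by omega)]
      linarith) n
  linarith

/-- The increments grow at most like a small power of `n`: since `E ∑ V_i^(1+ε) < 1`, a power is a
supersolution of their recursion for large `n`. -/
theorem exists_pathLengthIncrement_le (h : Admissible ν s s₀ s₁) :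
    ∃ B : ℝ, 0 ≤ B ∧ ∀ n : ℕ, pathLengthIncrement ν s s₀ s₁ n ≤ (n : ℝ) ^ (1 / 4 : ℝ) + B := by
  set e : ℝ := 1 / 4 with he
  have he0 : 0 < e := by norm_num [he]
  have he1 : e ≤ 1 := by norm_num [he]
  have hpc : Continuous fun x : ℝ => x ^ e := Real.continuous_rpow_const he0.le
  obtain ⟨hi, hρ⟩ := h.integral_sum_lt_one (φ := fun x => x * x ^ e)
    (continuous_id.mul hpc).measurable
    (fun x hx => mul_nonneg hx.1 (Real.rpow_nonneg hx.1 _))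
    (fun x hx => mul_le_of_le_one_right hx.1 (Real.rpow_le_one hx.1 hx.2 he0.le))
    (fun x hx => mul_lt_of_lt_one_right hx.1 (Real.rpow_lt_one hx.1.le hx.2 he0))
  set ρ := ∫ v, ∑ i, v i * v i ^ e ∂ν with hρdef
  have hlim : Tendsto (fun n : ℕ => (1 - ρ) * (n : ℝ) ^ e) atTop atTop :=
    ((tendsto_rpow_atTop he0).comp tendsto_natCast_atTop_atTop).const_mul_atTop (by linarith)
  obtain ⟨n₁, hn₁⟩ := eventually_atTop.1 (hlim.eventually_ge_atTop (1 + (s₁ : ℝ) ^ e))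
  set n₀ := max n₁ (s + 1) with hn₀
  set B := ∑ k ∈ Finset.range n₀, |pathLengthIncrement ν s s₀ s₁ k| with hB
  have hB0 : 0 ≤ B := Finset.sum_nonneg fun _ _ => abs_nonneg _
  refine ⟨B, hB0, fun n => ?_⟩
  have key := h.nonpos_of_le_mean
    (w := fun n => pathLengthIncrement ν s s₀ s₁ n - ((n : ℝ) ^ e + B)) (n₀ := n₀)
    (by omega) (fun k hk => ?_) (fun k hk => ?_) n
  · linarith
  · have h1 : |pathLengthIncrement ν s s₀ s₁ k| ≤ B :=
      Finset.single_le_sum (f := fun k => |pathLengthIncrement ν s s₀ s₁ k|)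
        (fun _ _ => abs_nonneg _) (Finset.mem_range.2 hk)
    have h2 := le_abs_self (pathLengthIncrement ν s s₀ s₁ k)
    have h3 : 0 ≤ (k : ℝ) ^ e := by positivity
    linarith
  · have hks : s < k := by omega
    set m := k - s₀ - b * s₁ with hm
    have hmk : (m : ℝ) ≤ k := by exact_mod_cast (by omega : m ≤ k)
    have hcont : ∀ (φ : ℕ → ℝ) (i : Fin b), Integrable
        (fun v => v i * binomialMean (v i) (1 - v i) m φ) ν := fun φ i =>
      h.integrable_comp (g := fun x => x * binomialMean x (1 - x) m φ)
        (continuous_id.mul (continuous_binomialMean _ _)) i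
    have hsup : ∑ i, ∫ v, v i * binomialMean (v i) (1 - v i) m
        (fun j => ((s₁ + j : ℕ) : ℝ) ^ e + B) ∂ν ≤ (s₁ : ℝ) ^ e + B + ρ * (k : ℝ) ^ e := by
      have hint2 : ∀ i : Fin b, Integrable (fun v => v i * v i ^ e * (k : ℝ) ^ e) ν := fun i =>
        (h.integrable_comp (g := fun x => x * x ^ e) (continuous_id.mul hpc) i).mul_const _
      have hint1 : ∀ i : Fin b, Integrable (fun v => v i * ((s₁ : ℝ) ^ e + B)) ν := fun i =>
        h.integrable_comp (g := fun x => x * ((s₁ : ℝ) ^ e + B)) (by fun_prop) i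
      have hstep : ∀ i : Fin b, ∫ v, v i * binomialMean (v i) (1 - v i) m
          (fun j => ((s₁ + j : ℕ) : ℝ) ^ e + B) ∂ν ≤
          ∫ v, v i * ((s₁ : ℝ) ^ e + B) ∂ν + ∫ v, v i * v i ^ e * (k : ℝ) ^ e ∂ν := by
        intro i
        rw [← integral_add (hint1 i) (hint2 i)]
        refine integral_mono_ae (hcont _ i) ((hint1 i).add (hint2 i)) ?_
        filter_upwards [h.mem_unit] with v hv
        have hv0 := (hv i).1
        have h1 : binomialMean (v i) (1 - v i) m (fun j => ((s₁ + j : ℕ) : ℝ) ^ e) ≤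
            (s₁ + m * v i) ^ e := by
          have := binomialMean_le_of_concaveOn (hv i) (Real.concaveOn_rpow he0.le he1) m
            (Nat.cast_nonneg (α := ℝ) s₁)
          simpa only [Nat.cast_add] using this
        have h2 : ((s₁ : ℝ) + m * v i) ^ e ≤ (s₁ : ℝ) ^ e + (k : ℝ) ^ e * v i ^ e := by
          have h3 := NNReal.rpow_add_le_add_rpow (s₁ : NNReal) (m * ⟨v i, hv0⟩) he0.le he1
          have h4 : ((s₁ : ℝ) + m * v i) ^ e ≤ (s₁ : ℝ) ^ e + (m * v i) ^ e := by
            exact_mod_cast h3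
          rw [← Real.mul_rpow (Nat.cast_nonneg k) hv0]
          refine h4.trans ?_
          gcongr
        rw [binomialMean_add, binomialMean_const (by ring)]
        calc v i * (binomialMean (v i) (1 - v i) m (fun j => ((s₁ + j : ℕ) : ℝ) ^ e) + B)
            ≤ v i * ((s₁ : ℝ) ^ e + (k : ℝ) ^ e * v i ^ e + B) := by
              have := h1.trans h2
              gcongr
          _ = v i * ((s₁ : ℝ) ^ e + B) + v i * v i ^ e * (k : ℝ) ^ e := by ring
      refine (Finset.sum_le_sum fun i _ => hstep i).trans (le_of_eq ?_)
      rw [Finset.sum_add_distrib, h.sum_integral_const_mul, hρdef, integral_finsetSum _ fun i _ =>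
        h.integrable_comp (g := fun x => x * x ^ e) (continuous_id.mul hpc) i, Finset.sum_mul]
      simp only [integral_mul_const]
    have hsplit : ∑ i, ∫ v, v i * binomialMean (v i) (1 - v i) m
        (fun j => pathLengthIncrement ν s s₀ s₁ (s₁ + j) - (((s₁ + j : ℕ) : ℝ) ^ e + B)) ∂ν =
        ∑ i, ∫ v, v i * binomialMean (v i) (1 - v i) m
          (fun j => pathLengthIncrement ν s s₀ s₁ (s₁ + j)) ∂ν -
        ∑ i, ∫ v, v i * binomialMean (v i) (1 - v i) m
          (fun j => ((s₁ + j : ℕ) : ℝ) ^ e + B) ∂ν := by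
      rw [← Finset.sum_sub_distrib]
      refine Finset.sum_congr rfl fun i _ => ?_
      rw [← integral_sub (hcont _ i) (hcont _ i)]
      simp only [binomialMean_sub, mul_sub]
    rw [hsplit, h.pathLengthIncrement_eq hks]
    have := hn₁ k (by omega)
    linarith

end Admissible

end SplitTree

/-! ### The step law and the interpolated path length -/

namespace SplitTree

open ProbabilityTheory Topology

/-- The law of `X = -ln V*`, where `V*` is the size-biased component of the split vector: its means
are `E φ(X) = ∑ i, E[V_i φ(-ln V_i)]`. -/
noncomputable def stepLaw {b : ℕ} (ν : Measure (Fin b → ℝ)) : Measure ℝ :=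
  ∑ i, (ν.withDensity fun v => ENNReal.ofReal (v i)).map fun v => -Real.log (v i)

/-- The piecewise linear interpolation of the expected path length, as the integral of its
increments. It vanishes for `t ≤ 1`. -/
noncomputable def interpolation {b : ℕ} (ν : Measure (Fin b → ℝ)) [IsProbabilityMeasure ν]
    (s s₀ s₁ : ℕ) (t : ℝ) : ℝ :=
  ∫ u in (0 : ℝ)..t, pathLengthIncrement ν s s₀ s₁ ⌊u⌋₊

section StepLaw

variable {b : ℕ} {ν : Measure (Fin b → ℝ)}

theorem measurable_neg_log_apply (i : Fin b) :
    Measurable fun v : Fin b → ℝ => -Real.log (v i) := by fun_prop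

theorem ae_stepLaw_iff {p : ℝ → Prop} (hp : MeasurableSet {y | p y}) :
    (∀ᵐ y ∂stepLaw ν, p y) ↔ ∀ i, ∀ᵐ v ∂ν, 0 < v i → p (-Real.log (v i)) := by
  simp only [stepLaw, ae_finsetSum_measure_iff, Finset.mem_univ, true_imp_iff]
  refine forall_congr' fun i => ?_
  rw [ae_map_iff (measurable_neg_log_apply i).aemeasurable hp, ae_withDensity_iff (by fun_prop)]
  simp only [ne_eq, ENNReal.ofReal_eq_zero, not_le]

theorem integrable_stepLaw {φ : ℝ → ℝ} (hφ : Measurable φ)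
    (hi : ∀ i, Integrable (fun v => v i * φ (-Real.log (v i))) ν)
    (h0 : ∀ᵐ v ∂ν, ∀ i, 0 ≤ v i) : Integrable φ (stepLaw ν) := by
  rw [stepLaw, integrable_finsetSum_measure]
  intro i _
  rw [integrable_map_measure hφ.aestronglyMeasurable (measurable_neg_log_apply i).aemeasurable,
    integrable_withDensity_iff_integrable_smul' (by fun_prop) (by simp)]
  refine (hi i).congr ?_
  filter_upwards [h0] with v hv
  simp [ENNReal.toReal_ofReal (hv i)]

theorem integral_stepLaw {φ : ℝ → ℝ} (hφ : Measurable φ)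
    (hi : ∀ i, Integrable (fun v => v i * φ (-Real.log (v i))) ν)
    (h0 : ∀ᵐ v ∂ν, ∀ i, 0 ≤ v i) :
    ∫ y, φ y ∂stepLaw ν = ∑ i, ∫ v, v i * φ (-Real.log (v i)) ∂ν := by
  have h1 := integrable_stepLaw hφ hi h0
  rw [stepLaw, integrable_finsetSum_measure] at h1
  rw [stepLaw, integral_finsetSum_measure h1]
  refine Finset.sum_congr rfl fun i _ => ?_
  rw [integral_map (measurable_neg_log_apply i).aemeasurable hφ.aestronglyMeasurable,
    integral_withDensity_eq_integral_toReal_smul (by fun_prop) (by simp)]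
  refine integral_congr_ae ?_
  filter_upwards [h0] with v hv
  simp [ENNReal.toReal_ofReal (hv i)]

end StepLaw

namespace Admissible

variable {b : ℕ} {ν : Measure (Fin b → ℝ)} {s s₀ s₁ : ℕ}

theorem nonneg (h : Admissible ν s s₀ s₁) : ∀ᵐ v ∂ν, ∀ i, 0 ≤ v i :=
  h.simplex.mono fun _ hv => hv.1

theorem stepLaw_nonneg (h : Admissible ν s s₀ s₁) : ∀ᵐ y ∂stepLaw ν, 0 ≤ y := by
  rw [ae_stepLaw_iff measurableSet_Ici]
  intro i
  filter_upwards [h.mem_unit] with v hv hpos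
  exact neg_nonneg.2 (Real.log_nonpos (hv i).1 (hv i).2)

variable [IsProbabilityMeasure ν]

theorem isProbabilityMeasure_stepLaw (h : Admissible ν s s₀ s₁) :
    IsProbabilityMeasure (stepLaw ν) := by
  constructor
  rw [stepLaw, Measure.finsetSum_apply]
  have h1 : ∀ i : Fin b, ((ν.withDensity fun v => ENNReal.ofReal (v i)).map
      fun v => -Real.log (v i)) univ = ∫⁻ v, ENNReal.ofReal (v i) ∂ν := fun i => by
    rw [Measure.map_apply (by fun_prop) MeasurableSet.univ, preimage_univ,
      withDensity_apply _ MeasurableSet.univ, Measure.restrict_univ]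
  simp only [h1]
  rw [← lintegral_finsetSum _ fun i _ => by fun_prop]
  rw [lintegral_congr_ae (g := fun _ => 1)]
  · simp
  · filter_upwards [h.simplex] with v hv
    rw [← ENNReal.ofReal_sum_of_nonneg fun i _ => hv.1 i, hv.2, ENNReal.ofReal_one]

theorem stepLaw_Ioi_pos (h : Admissible ν s s₀ s₁) : 0 < stepLaw ν (Ioi 0) := by
  rw [pos_iff_ne_zero]
  intro h0
  have h1 : ∀ᵐ y ∂stepLaw ν, y ≤ 0 := by
    rw [ae_iff]
    simpa [Ioi] using h0
  rw [ae_stepLaw_iff measurableSet_Iic] at h1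
  apply h.not_ae_one
  filter_upwards [ae_all_iff.2 h1, h.mem_unit, h.simplex] with v hv hv1 hv2
  by_contra! hne
  have h5 : ∀ i, v i = 0 := by
    intro i
    by_contra hi
    have hpos := lt_of_le_of_ne (hv1 i).1 (Ne.symm hi)
    have h6 := Real.log_neg hpos (lt_of_le_of_ne (hv1 i).2 (hne i))
    linarith [hv i hpos]
  have := hv2.2
  simp [h5] at this

theorem mul_exp_neg_log_le_one {c x : ℝ} (hc : c ≤ 1) (hx : x ∈ Icc (0 : ℝ) 1) :
    x * Real.exp (c * -Real.log x) ≤ 1 := by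
  rcases hx.1.eq_or_lt with h0 | h0
  · simp [← h0]
  · have h1 : x * Real.exp (c * -Real.log x) = Real.exp ((1 - c) * Real.log x) := by
      conv_lhs => rw [← Real.exp_log h0]
      rw [← Real.exp_add, Real.log_exp]
      congr 1; ring
    rw [h1, Real.exp_le_one_iff]
    exact mul_nonpos_of_nonneg_of_nonpos (by linarith) (Real.log_nonpos hx.1 hx.2)

theorem integrable_exp_stepLaw (h : Admissible ν s s₀ s₁) {c : ℝ} (hc : c ≤ 1) :
    Integrable (fun y => Real.exp (c * y)) (stepLaw ν) := by
  refine integrable_stepLaw (by fun_prop) (fun i => ?_) h.nonneg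
  refine Integrable.of_bound (C := 1) (by fun_prop) ?_
  filter_upwards [h.mem_unit] with v hv
  rw [Real.norm_eq_abs, abs_of_nonneg (mul_nonneg (hv i).1 (Real.exp_pos _).le)]
  exact mul_exp_neg_log_le_one hc (hv i)

theorem integrable_entropy (h : Admissible ν s s₀ s₁) (i : Fin b) :
    Integrable (fun v => v i * -Real.log (v i)) ν :=
  (h.integrable_comp Real.continuous_mul_log i).neg.congr (Eventually.of_forall fun v => by simp)

theorem integrable_id_stepLaw (h : Admissible ν s s₀ s₁) :
    Integrable (fun y => y) (stepLaw ν) :=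
  integrable_stepLaw measurable_id h.integrable_entropy h.nonneg

/-- The mean step is the entropy constant `μ`. -/
theorem integral_id_stepLaw (h : Admissible ν s s₀ s₁) :
    ∫ y, y ∂stepLaw ν = entropyConst ν := by
  rw [integral_stepLaw (φ := fun y => y) measurable_id h.integrable_entropy h.nonneg, entropyConst,
    componentLaw, integral_smul_measure, integral_finsetSum_measure]
  · have hb : (b : ℝ) ≠ 0 := by
      have := h.two_le
      positivity
    rw [smul_eq_mul, ENNReal.toReal_inv, ENNReal.toReal_natCast, mul_inv_cancel_left₀ hb]
    refine Finset.sum_congr rfl fun i _ => ?_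
    rw [integral_map (measurable_pi_apply i).aemeasurable (by fun_prop)]
    simp only [mul_neg]
  · intro i _
    have hm : Measurable fun v : Fin b → ℝ => v i := measurable_pi_apply i
    rw [integrable_map_measure (by fun_prop) hm.aemeasurable]
    exact (h.integrable_comp Real.continuous_mul_log i).neg

theorem entropyConst_pos (h : Admissible ν s s₀ s₁) : 0 < entropyConst ν := by
  rw [← h.integral_id_stepLaw, integral_pos_iff_support_of_nonneg_ae h.stepLaw_nonneg
    h.integrable_id_stepLaw]
  refine h.stepLaw_Ioi_pos.trans_le (measure_mono fun y hy => ?_)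
  exact ne_of_gt hy

/-- `x - E (x - X)⁺` approaches `E X` exponentially fast; for `x ≥ 0` this measures by how much
`x ↦ x⁺ / μ` fails to solve the renewal equation with source `1`. -/
theorem abs_integral_max_sub_le (h : Admissible ν s s₀ s₁) (x : ℝ) :
    |x - ∫ y, max (x - y) 0 ∂stepLaw ν - entropyConst ν| ≤
      4 * (∫ y, Real.exp (1 / 4 * y) ∂stepLaw ν) * Real.exp (-(1 / 4) * x) := by
  have hP := h.isProbabilityMeasure_stepLaw
  have hexp := h.integrable_exp_stepLaw (c := 1 / 4) (by norm_num)
  have hid := h.integrable_id_stepLaw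
  have hi : Integrable (fun y => max (y - x) 0) (stepLaw ν) :=
    (hid.sub (integrable_const x)).pos_part
  have e : ∀ y, max (x - y) 0 = x - y + max (y - x) 0 := by
    intro y
    rcases le_total x y with hxy | hxy
    · rw [max_eq_right (by linarith), max_eq_left (by linarith)]; ring
    · rw [max_eq_left (by linarith), max_eq_right (by linarith)]; ring
  have hsub : Integrable (fun y => x - y) (stepLaw ν) := (integrable_const x).sub hid
  have hmean : ∫ y, (x - y) ∂stepLaw ν = x - entropyConst ν := by
    rw [integral_sub (integrable_const x) hid, h.integral_id_stepLaw]
    simp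
  simp only [e]
  rw [integral_add hsub hi, hmean,
    show x - (x - entropyConst ν + ∫ y, max (y - x) 0 ∂stepLaw ν) - entropyConst ν =
      -∫ y, max (y - x) 0 ∂stepLaw ν by ring, abs_neg,
    abs_of_nonneg (integral_nonneg fun y => le_max_right _ _),
    mul_right_comm, ← integral_const_mul]
  refine integral_mono hi (hexp.const_mul _) fun y => ?_
  simp only
  rw [mul_assoc, ← Real.exp_add]
  have := Real.add_one_le_exp (-(1 / 4) * x + 1 / 4 * y)
  have h2 := Real.exp_pos (-(1 / 4) * x + 1 / 4 * y)
  exact max_le (by linarith) (by linarith)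

section Interpolation

variable {B : ℝ}

theorem norm_pathLengthIncrement_floor_le (h : Admissible ν s s₀ s₁)
    (hB : ∀ n : ℕ, pathLengthIncrement ν s s₀ s₁ n ≤ (n : ℝ) ^ (1 / 4 : ℝ) + B) {u T : ℝ}
    (hT : 0 ≤ T) (hu : u ≤ T) :
    ‖pathLengthIncrement ν s s₀ s₁ ⌊u⌋₊‖ ≤ T ^ (1 / 4 : ℝ) + B := by
  rw [Real.norm_eq_abs, abs_of_nonneg (h.pathLengthIncrement_nonneg _)]
  refine (hB _).trans ?_
  have h1 : (⌊u⌋₊ : ℝ) ≤ T := (Nat.cast_le.2 (Nat.floor_mono hu)).trans (Nat.floor_le hT)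
  gcongr

theorem intervalIntegrable_increment (h : Admissible ν s s₀ s₁) (a c : ℝ) :
    IntervalIntegrable (fun u => pathLengthIncrement ν s s₀ s₁ ⌊u⌋₊) volume a c := by
  obtain ⟨B, -, hB⟩ := h.exists_pathLengthIncrement_le
  have hm : Measurable fun u : ℝ => pathLengthIncrement ν s s₀ s₁ ⌊u⌋₊ :=
    (measurable_of_countable fun n => pathLengthIncrement ν s s₀ s₁ n).comp Nat.measurable_floor
  rw [intervalIntegrable_iff]
  refine Measure.integrableOn_of_bounded (M := (max (max a c) 0) ^ (1 / 4 : ℝ) + B) (by simp)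
    hm.aestronglyMeasurable ?_
  filter_upwards [ae_restrict_mem measurableSet_uIoc] with u hu
  exact h.norm_pathLengthIncrement_floor_le hB (le_max_right _ _) (hu.2.trans (le_max_left _ _))

theorem interpolation_sub (h : Admissible ν s s₀ s₁) (a c : ℝ) :
    interpolation ν s s₀ s₁ c - interpolation ν s s₀ s₁ a =
      ∫ u in a..c, pathLengthIncrement ν s s₀ s₁ ⌊u⌋₊ := by
  rw [interpolation, interpolation, intervalIntegral.integral_interval_sub_left
    (h.intervalIntegrable_increment _ _) (h.intervalIntegrable_increment _ _)]

theorem abs_interpolation_sub_le (h : Admissible ν s s₀ s₁)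
    (hB : ∀ n : ℕ, pathLengthIncrement ν s s₀ s₁ n ≤ (n : ℝ) ^ (1 / 4 : ℝ) + B) {a c T : ℝ}
    (hT : 0 ≤ T) (ha : a ≤ T) (hc : c ≤ T) :
    |interpolation ν s s₀ s₁ c - interpolation ν s s₀ s₁ a| ≤ (T ^ (1 / 4 : ℝ) + B) * |c - a| := by
  rw [h.interpolation_sub]
  exact intervalIntegral.norm_integral_le_of_norm_le_const fun u hu =>
    h.norm_pathLengthIncrement_floor_le hB hT (hu.2.trans (max_le ha hc))

theorem continuous_interpolation (h : Admissible ν s s₀ s₁) :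
    Continuous (interpolation ν s s₀ s₁) :=
  intervalIntegral.continuous_primitive (fun a c => h.intervalIntegrable_increment a c) 0

/-- A single item is stored at the root; if `s = 0`, this is because the parameters force `s₀ = 1` and
`s₁ = 0`. Hence the interpolation vanishes on `[0, 1]`. -/
theorem meanPathLength_one (h : Admissible ν s s₀ s₁) : meanPathLength ν s s₀ s₁ 1 = 0 := by
  rcases Nat.lt_or_ge 0 s with hs | hs
  · exact h.meanPathLength_of_le hs
  · have h1 := h.store
    have h2 := h.param
    have h3 := Nat.mul_le_mul_right s₁ h.two_le
    obtain rfl : s = 0 := by omega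
    obtain rfl : s₀ = 1 := by omega
    obtain rfl : s₁ = 0 := by omega
    rw [h.meanPathLength_eq one_pos]
    simp [binomialMean, h.meanPathLength_of_le le_rfl]

theorem pathLengthIncrement_zero (h : Admissible ν s s₀ s₁) :
    pathLengthIncrement ν s s₀ s₁ 0 = 0 := by
  rw [pathLengthIncrement, zero_add, h.meanPathLength_one, h.meanPathLength_of_le (Nat.zero_le s),
    sub_zero]

theorem interpolation_of_le_one (h : Admissible ν s s₀ s₁) {t : ℝ} (ht : t ≤ 1) :
    interpolation ν s s₀ s₁ t = 0 := by
  refine intervalIntegral.integral_zero_ae ?_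
  filter_upwards [Measure.ae_ne volume (1 : ℝ)] with u hu1 hu
  have h1 : u ≤ 1 := hu.2.trans (max_le zero_le_one ht)
  rw [Nat.floor_eq_zero.2 (lt_of_le_of_ne h1 hu1), h.pathLengthIncrement_zero]

theorem interpolation_natCast (h : Admissible ν s s₀ s₁) (n : ℕ) :
    interpolation ν s s₀ s₁ n = meanPathLength ν s s₀ s₁ n := by
  induction n with
  | zero =>
    rw [Nat.cast_zero, h.interpolation_of_le_one zero_le_one,
      h.meanPathLength_of_le (Nat.zero_le s)]
  | succ n ih =>
    have h1 := h.interpolation_sub n (n + 1 : ℕ)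
    have h2 : ∫ u in (n : ℝ)..(n + 1 : ℕ), pathLengthIncrement ν s s₀ s₁ ⌊u⌋₊ =
        ∫ _ in (n : ℝ)..(n + 1 : ℕ), pathLengthIncrement ν s s₀ s₁ n := by
      refine intervalIntegral.integral_congr_ae ?_
      filter_upwards [Measure.ae_ne volume ((n + 1 : ℕ) : ℝ)] with u hu1 hu
      rw [uIoc_of_le (by simp)] at hu
      have h3 : ⌊u⌋₊ = n := by
        rw [Nat.floor_eq_iff ((Nat.cast_nonneg n).trans hu.1.le)]
        refine ⟨hu.1.le, ?_⟩
        have := lt_of_le_of_ne hu.2 hu1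
        push_cast at this
        exact this
      rw [h3]
    rw [h2, intervalIntegral.integral_const, ih, pathLengthIncrement] at h1
    push_cast at h1 ⊢
    simp only [add_sub_cancel_left, one_smul] at h1
    linarith

/-- The interpolated expected path length satisfies the recursion with the binomial cardinalities
replaced by their approximate means `t V_i`, up to an error of order `t^(3/4)`: the standard
deviation of the cardinalities is at most `√t`, and the increments are at most of order
`t^(1/4)`. -/
theorem exists_interpolation_error (h : Admissible ν s s₀ s₁) :
    ∃ C : ℝ, 0 ≤ C ∧ ∀ t : ℝ, (s : ℝ) + 1 ≤ t →
      |interpolation ν s s₀ s₁ t - ∑ i, ∫ v, interpolation ν s s₀ s₁ (t * v i) ∂ν - t| ≤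
        C * t ^ (3 / 4 : ℝ) := by
  obtain ⟨B, hB0, hB⟩ := h.exists_pathLengthIncrement_le
  set k : ℝ := 1 + s₀ + b * s₁ with hk
  have hk0 : 0 ≤ k := by positivity
  refine ⟨(1 + B) * (1 + b * (1 + s₁ + k)) + (s₀ + 1), by positivity, fun t ht => ?_⟩
  have ht1 : 1 ≤ t := le_trans (by simp) ht
  have ht0 : 0 < t := by linarith
  set n := ⌊t⌋₊ with hn
  have hsn : s < n := Nat.lt_of_succ_le (Nat.le_floor (by push_cast; exact ht))
  have hnt : (n : ℝ) ≤ t := Nat.floor_le ht0.le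
  have htn : t < n + 1 := Nat.lt_floor_add_one t
  set m := n - s₀ - b * s₁ with hm
  have hpar := h.param
  have hmn : (m : ℝ) = n - s₀ - b * s₁ := by
    rw [hm, Nat.cast_sub (by omega), Nat.cast_sub (by omega), Nat.cast_mul]
  set Λ := t ^ (1 / 4 : ℝ) + B with hΛ
  have hp1 : 1 ≤ t ^ (1 / 4 : ℝ) := Real.one_le_rpow ht1 (by norm_num)
  have hΛ0 : 0 ≤ Λ := by linarith
  have hs1 : 1 ≤ √t := Real.one_le_sqrt.2 ht1
  -- Replacing `t` by `n` and the cardinality of a child by `t v`.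
  have hfloor : |interpolation ν s s₀ s₁ t - meanPathLength ν s s₀ s₁ n| ≤ Λ := by
    rw [← h.interpolation_natCast]
    refine (h.abs_interpolation_sub_le hB ht0.le hnt le_rfl).trans ?_
    refine mul_le_of_le_one_right hΛ0 ?_
    rw [abs_of_nonneg (by linarith)]
    linarith
  have hchild : ∀ (i : Fin b) (v : ℝ), v ∈ Icc (0 : ℝ) 1 →
      |binomialMean v (1 - v) m (fun j => meanPathLength ν s s₀ s₁ (s₁ + j)) -
        interpolation ν s s₀ s₁ (t * v)| ≤ Λ * ((1 + s₁ + k) * √t) := by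
    intro i v hv
    have hv0 := hv.1
    have hv1 : 0 ≤ 1 - v := sub_nonneg.2 hv.2
    have htv : t * v ≤ t := mul_le_of_le_one_right ht0.le hv.2
    have h1 : binomialMean v (1 - v) m (fun j => meanPathLength ν s s₀ s₁ (s₁ + j)) -
        interpolation ν s s₀ s₁ (t * v) = binomialMean v (1 - v) m (fun j =>
          interpolation ν s s₀ s₁ ((s₁ + j : ℕ) : ℝ) - interpolation ν s s₀ s₁ (t * v)) := by
      rw [binomialMean_sub, binomialMean_const (by ring)]
      simp only [h.interpolation_natCast]
    rw [h1]
    refine (abs_binomialMean_le hv0 hv1 _ _).trans ?_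
    have h2 : binomialMean v (1 - v) m (fun j => |interpolation ν s s₀ s₁ ((s₁ + j : ℕ) : ℝ) -
        interpolation ν s s₀ s₁ (t * v)|) ≤
        binomialMean v (1 - v) m (fun j => Λ * (|(j : ℝ) - m * v| + (s₁ + k))) := by
      refine binomialMean_mono hv0 hv1 fun j hj => ?_
      have h3 : ((s₁ + j : ℕ) : ℝ) ≤ t :=
        le_trans (Nat.cast_le.2 (h.add_le_of_le i hsn hj)) hnt
      refine (h.abs_interpolation_sub_le hB ht0.le htv h3).trans ?_
      refine mul_le_mul_of_nonneg_left ?_ hΛ0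
      have h4 : ((s₁ + j : ℕ) : ℝ) - t * v = (j - m * v) + (s₁ - (t - m) * v) := by
        push_cast; ring
      have h5 : 0 ≤ (t - m) * v := mul_nonneg (by
        have : (0 : ℝ) ≤ s₀ + b * s₁ := by positivity
        linarith) hv0
      have h6 : (t - m) * v ≤ k := by
        have h7 : t - m ≤ k := by rw [hmn, hk]; linarith
        nlinarith [hv.2]
      have h7 : |(s₁ : ℝ) - (t - m) * v| ≤ s₁ + k := by
        have : (0 : ℝ) ≤ s₁ := Nat.cast_nonneg _
        rw [abs_le]
        constructor <;> linarith
      rw [h4]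
      exact (abs_add_le _ _).trans (by linarith)
    rw [binomialMean_const_mul, binomialMean_add, binomialMean_const (by ring)] at h2
    have hmt : (m : ℝ) ≤ t := le_trans (Nat.cast_le.2 (by omega)) hnt
    have h8 := binomialMean_abs_sub_le hv ht0 hmt
    refine h2.trans (mul_le_mul_of_nonneg_left ?_ hΛ0)
    have h9 : 0 ≤ (s₁ : ℝ) + k := by positivity
    nlinarith
  have hint1 : ∀ i : Fin b, Integrable (fun v => binomialMean (v i) (1 - v i) m
      (fun j => meanPathLength ν s s₀ s₁ (s₁ + j))) ν := fun i =>
    h.integrable_comp (continuous_binomialMean _ _) i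
  have hint2 : ∀ i : Fin b, Integrable (fun v => interpolation ν s s₀ s₁ (t * v i)) ν := fun i =>
    h.integrable_comp (g := fun x => interpolation ν s s₀ s₁ (t * x))
      (h.continuous_interpolation.comp (by fun_prop)) i
  have hsum : |∑ i, ∫ v, binomialMean (v i) (1 - v i) m
        (fun j => meanPathLength ν s s₀ s₁ (s₁ + j)) ∂ν -
      ∑ i, ∫ v, interpolation ν s s₀ s₁ (t * v i) ∂ν| ≤ b * (Λ * ((1 + s₁ + k) * √t)) := by
    rw [← Finset.sum_sub_distrib]
    refine (Finset.abs_sum_le_sum_abs _ _).trans ?_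
    refine (Finset.sum_le_card_nsmul _ _ (Λ * ((1 + s₁ + k) * √t)) fun i _ => ?_).trans
      (by simp)
    rw [← integral_sub (hint1 i) (hint2 i), ← Real.norm_eq_abs]
    refine (norm_integral_le_of_norm_le_const (C := Λ * ((1 + s₁ + k) * √t)) ?_).trans (by simp)
    filter_upwards [h.mem_unit] with v hv
    exact hchild i (v i) (hv i)
  have hrec := h.meanPathLength_eq hsn
  have habs : |interpolation ν s s₀ s₁ t -
      ∑ i, ∫ v, interpolation ν s s₀ s₁ (t * v i) ∂ν - t| ≤
      Λ + b * (Λ * ((1 + s₁ + k) * √t)) + (s₀ + 1) := by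
    have h0 : (0 : ℝ) ≤ s₀ := Nat.cast_nonneg _
    rw [abs_le] at hfloor hsum ⊢
    constructor <;> linarith
  have hpow : t ^ (3 / 4 : ℝ) = t ^ (1 / 4 : ℝ) * √t := by
    rw [Real.sqrt_eq_rpow, ← Real.rpow_add ht0]; norm_num
  have hΛle : Λ ≤ (1 + B) * t ^ (1 / 4 : ℝ) := by rw [hΛ]; nlinarith
  refine habs.trans ?_
  rw [hpow]
  set a := t ^ (1 / 4 : ℝ) with ha
  have ha0 : 0 < a := by linarith
  have h1 : Λ ≤ (1 + B) * (a * √t) := by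
    refine hΛle.trans (mul_le_mul_of_nonneg_left ?_ (by linarith))
    exact le_mul_of_one_le_right ha0.le hs1
  have h2 : b * (Λ * ((1 + s₁ + k) * √t)) ≤ b * (((1 + B) * a) * ((1 + s₁ + k) * √t)) := by
    gcongr
  have h3 : ((s₀ : ℝ) + 1) * 1 ≤ (s₀ + 1) * (a * √t) := by
    have : 1 ≤ a * √t := one_le_mul_of_one_le_of_one_le hp1 hs1
    gcongr
  calc Λ + b * (Λ * ((1 + s₁ + k) * √t)) + (s₀ + 1)
      ≤ (1 + B) * (a * √t) + b * (((1 + B) * a) * ((1 + s₁ + k) * √t)) +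
        (s₀ + 1) * (a * √t) := by linarith
    _ = ((1 + B) * (1 + b * (1 + s₁ + k)) + (s₀ + 1)) * (a * √t) := by ring

end Interpolation

end Admissible

end SplitTree

/-! ### The renewal equation and the lattice dichotomy -/

namespace SplitTree

open ProbabilityTheory Topology

theorem continuous_integral_comp_sub {P : Measure ℝ} [IsFiniteMeasure P]
    (hP0 : ∀ᵐ y ∂P, 0 ≤ y) {H : ℝ → ℝ} (hH : Continuous H) (hz : ∀ x ≤ 0, H x = 0) :
    Continuous fun x => ∫ y, H (x - y) ∂P := by
  refine continuous_iff_continuousAt.2 fun x₀ => ?_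
  obtain ⟨M, hM⟩ := (isCompact_Icc (a := (0 : ℝ)) (b := x₀ + 1)).exists_bound_of_continuousOn
    hH.continuousOn
  refine continuousAt_of_dominated (bound := fun _ => max M 0) ?_ ?_ (integrable_const _) ?_
  · exact Eventually.of_forall fun x => Continuous.aestronglyMeasurable (by fun_prop)
  · filter_upwards [Iic_mem_nhds (show x₀ < x₀ + 1 by linarith)] with x hx
    filter_upwards [hP0] with y hy
    have hx : x ≤ x₀ + 1 := hx
    rcases le_total (x - y) 0 with h0 | h0
    · simp [hz _ h0]
    · exact (hM _ ⟨h0, by linarith⟩).trans (le_max_left _ _)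
  · exact Eventually.of_forall fun y => Continuous.continuousAt (by fun_prop)

/-- A continuous function vanishing on the negative half-line is a renewal solution as soon as its
source decays exponentially at infinity. -/
theorem exists_isRenewalSolution {P : Measure ℝ} [IsFiniteMeasure P]
    (hP0 : ∀ᵐ y ∂P, 0 ≤ y) {H : ℝ → ℝ} (hH : Continuous H) (hz : ∀ x ≤ 0, H x = 0) {c C₀ x₀ : ℝ}
    (hc : 0 ≤ c) (hdecay : ∀ x, x₀ ≤ x → |H x - ∫ y, H (x - y) ∂P| ≤ C₀ * Real.exp (-c * x)) :
    ∃ C, IsRenewalSolution P c C H fun x => H x - ∫ y, H (x - y) ∂P := by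
  have hr : Continuous fun x => H x - ∫ y, H (x - y) ∂P :=
    hH.sub (continuous_integral_comp_sub hP0 hH hz)
  obtain ⟨M, hM⟩ := (isCompact_Icc (a := (0 : ℝ)) (b := x₀)).exists_bound_of_continuousOn
    hr.continuousOn
  refine ⟨max C₀ (max M 0 * Real.exp (c * x₀)), hH, hz, hr, fun x => by ring, fun x => ?_⟩
  have hC : 0 ≤ max C₀ (max M 0 * Real.exp (c * x₀)) :=
    le_max_of_le_right (mul_nonneg (le_max_right _ _) (Real.exp_pos _).le)
  rcases le_total x 0 with h0 | h0
  · have h1 : ∫ y, H (x - y) ∂P = 0 := by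
      rw [integral_congr_ae (g := fun _ => (0 : ℝ)) (by
        filter_upwards [hP0] with y hy; exact hz _ (by linarith))]
      simp
    simp only [h1, hz x h0, sub_zero, abs_zero]
    positivity
  rcases le_total x₀ x with h1 | h1
  · exact (hdecay x h1).trans (by gcongr; exact le_max_left _ _)
  · calc |H x - ∫ y, H (x - y) ∂P| ≤ max M 0 * 1 := by
          rw [mul_one]; exact (hM x ⟨h0, h1⟩).trans (le_max_left _ _)
      _ ≤ max M 0 * Real.exp (c * x₀ + -c * x) := by
          refine mul_le_mul_of_nonneg_left (Real.one_le_exp ?_) (le_max_right _ _)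
          have := mul_le_mul_of_nonneg_left h1 hc
          linarith
      _ = max M 0 * Real.exp (c * x₀) * Real.exp (-c * x) := by rw [Real.exp_add, mul_assoc]
      _ ≤ _ := by gcongr; exact le_max_right _ _

/-- The expected path length in logarithmic scale, divided by the number of items and centred at its
leading term. -/
noncomputable def centredPathLength {b : ℕ} (ν : Measure (Fin b → ℝ)) [IsProbabilityMeasure ν]
    (s s₀ s₁ : ℕ) (x : ℝ) : ℝ :=
  Real.exp (-x) * interpolation ν s s₀ s₁ (Real.exp x) - (entropyConst ν)⁻¹ * max x 0

/-- Size-biasing only ignores the value `V = 0`, on which lattices impose no constraint. -/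
theorem logInMultiples_iff {b : ℕ} (ν : Measure (Fin b → ℝ)) (a : ℝ) :
    LogInMultiples ν a ↔ ∀ᵐ y ∂stepLaw ν, y ∈ AddSubgroup.zmultiples a := by
  have hb : (b : ℝ≥0∞)⁻¹ ≠ 0 := ENNReal.inv_ne_zero.2 (ENNReal.natCast_ne_top b)
  have hmem : ∀ x : ℝ, (∃ k : ℤ, Real.log x = k * a) ↔ -Real.log x ∈ AddSubgroup.zmultiples a := by
    intro x
    rw [neg_mem_iff, AddSubgroup.mem_zmultiples_iff]
    simp only [zsmul_eq_mul, eq_comm]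
  have hm : MeasurableSet {y : ℝ | y ∈ AddSubgroup.zmultiples a} := by
    refine Set.Countable.measurableSet ?_
    exact countable_range fun k : ℤ => k • a
  have hm2 : MeasurableSet {x : ℝ | 0 < x → ∃ k : ℤ, Real.log x = k * a} := by
    simp only [hmem]
    have h1 : {x : ℝ | 0 < x → -Real.log x ∈ AddSubgroup.zmultiples a} =
        (Ioi 0)ᶜ ∪ (fun x => -Real.log x) ⁻¹' {y | y ∈ AddSubgroup.zmultiples a} := by
      ext x
      simp [imp_iff_not_or]
    rw [h1]
    exact measurableSet_Ioi.compl.union (Real.measurable_log.neg hm)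
  rw [ae_stepLaw_iff hm, LogInMultiples, componentLaw, Measure.ae_ennreal_smul_measure_iff hb,
    ae_finsetSum_measure_iff]
  simp only [Finset.mem_univ, true_imp_iff]
  refine forall_congr' fun i => ?_
  have hmi : Measurable fun v : Fin b → ℝ => v i := measurable_pi_apply i
  rw [ae_map_iff hmi.aemeasurable hm2]
  simp only [hmem]

namespace Admissible

variable {b : ℕ} {ν : Measure (Fin b → ℝ)} [IsProbabilityMeasure ν] {s s₀ s₁ : ℕ}

/-- The size-biasing in `stepLaw` compensates the change of the normalising factor `exp(-x)`. A zero
component contributes nothing on either side, as the interpolation vanishes at `0`. -/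
theorem integral_exp_mul_interpolation (h : Admissible ν s s₀ s₁) (x : ℝ) :
    Integrable (fun y => Real.exp (-(x - y)) * interpolation ν s s₀ s₁ (Real.exp (x - y)))
      (stepLaw ν) ∧
    ∫ y, Real.exp (-(x - y)) * interpolation ν s s₀ s₁ (Real.exp (x - y)) ∂stepLaw ν =
      Real.exp (-x) * ∑ i, ∫ v, interpolation ν s s₀ s₁ (Real.exp x * v i) ∂ν := by
  have hc := h.continuous_interpolation
  have hm : Measurable fun y =>
      Real.exp (-(x - y)) * interpolation ν s s₀ s₁ (Real.exp (x - y)) :=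
    Continuous.measurable (by fun_prop)
  have e : ∀ i, (fun v : Fin b → ℝ => Real.exp (-x) * interpolation ν s s₀ s₁ (Real.exp x * v i))
      =ᵐ[ν] fun v => v i * (Real.exp (-(x - -Real.log (v i))) *
        interpolation ν s s₀ s₁ (Real.exp (x - -Real.log (v i)))) := by
    intro i
    filter_upwards [h.nonneg] with v hv
    rcases (hv i).eq_or_lt with h0 | h0
    · rw [← h0, mul_zero, h.interpolation_of_le_one zero_le_one, mul_zero, zero_mul]
    · rw [sub_neg_eq_add, Real.exp_add, Real.exp_log h0, neg_add, Real.exp_add, Real.exp_neg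
        (Real.log _), Real.exp_log h0]
      field_simp
  have hi : ∀ i : Fin b, Integrable
      (fun v => Real.exp (-x) * interpolation ν s s₀ s₁ (Real.exp x * v i)) ν := fun i =>
    h.integrable_comp (g := fun z => Real.exp (-x) * interpolation ν s s₀ s₁ (Real.exp x * z))
      (by fun_prop) i
  refine ⟨integrable_stepLaw hm (fun i => (hi i).congr (e i)) h.nonneg, ?_⟩
  rw [integral_stepLaw hm (fun i => (hi i).congr (e i)) h.nonneg, Finset.mul_sum]
  refine Finset.sum_congr rfl fun i _ => ?_
  rw [← integral_congr_ae (e i), integral_const_mul]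

/-- Of the two terms of `centredPathLength`, the first solves the renewal equation with a source
tending to `1`, by the interpolated recursion, and the second with a source tending to the
same limit `1`. -/
theorem exists_isRenewalSolution_centredPathLength (h : Admissible ν s s₀ s₁) :
    ∃ C r, IsRenewalSolution (stepLaw ν) (1 / 4) C (centredPathLength ν s s₀ s₁) r := by
  have hP := h.isProbabilityMeasure_stepLaw
  have hμ := h.entropyConst_pos
  have hc := h.continuous_interpolation
  have hcont : Continuous (centredPathLength ν s s₀ s₁) := by
    unfold centredPathLength
    fun_prop
  have hzero : ∀ x ≤ 0, centredPathLength ν s s₀ s₁ x = 0 := fun x hx => by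
    rw [centredPathLength, h.interpolation_of_le_one (Real.exp_le_one_iff.2 hx), max_eq_right hx]
    simp
  obtain ⟨C₁, hC₁, herr⟩ := h.exists_interpolation_error
  set E := ∫ y, Real.exp (1 / 4 * y) ∂stepLaw ν with hE
  obtain ⟨C, hC⟩ := exists_isRenewalSolution (c := 1 / 4) (x₀ := Real.log (s + 1))
    (C₀ := C₁ + (entropyConst ν)⁻¹ * (4 * E)) h.stepLaw_nonneg hcont hzero (by norm_num)
    fun x hx => by
      have hx0 : 0 ≤ x := (Real.log_nonneg (by simp)).trans hx
      have ht : (s : ℝ) + 1 ≤ Real.exp x := by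
        rwa [Real.log_le_iff_le_exp (by positivity)] at hx
      obtain ⟨hi, he⟩ := h.integral_exp_mul_interpolation x
      have hmax : Integrable (fun y => (entropyConst ν)⁻¹ * max (x - y) 0) (stepLaw ν) := by
        have h1 : Integrable (fun y => x - y) (stepLaw ν) :=
          (integrable_const x).sub h.integrable_id_stepLaw
        exact h1.pos_part.const_mul _
      have h1 : ∫ y, centredPathLength ν s s₀ s₁ (x - y) ∂stepLaw ν =
          Real.exp (-x) * ∑ i, ∫ v, interpolation ν s s₀ s₁ (Real.exp x * v i) ∂ν -
            (entropyConst ν)⁻¹ * ∫ y, max (x - y) 0 ∂stepLaw ν := by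
        simp only [centredPathLength]
        rw [integral_sub hi hmax, he, integral_const_mul]
      set S := ∑ i, ∫ v, interpolation ν s s₀ s₁ (Real.exp x * v i) ∂ν with hS
      set J := ∫ y, max (x - y) 0 ∂stepLaw ν with hJ
      have h2 : centredPathLength ν s s₀ s₁ x - (Real.exp (-x) * S - (entropyConst ν)⁻¹ * J) =
          Real.exp (-x) * (interpolation ν s s₀ s₁ (Real.exp x) - S - Real.exp x) -
            (entropyConst ν)⁻¹ * (x - J - entropyConst ν) := by
        have h3 : Real.exp (-x) * Real.exp x = 1 := by rw [← Real.exp_add]; simp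
        have h4 : (entropyConst ν)⁻¹ * entropyConst ν = 1 := inv_mul_cancel₀ hμ.ne'
        rw [centredPathLength, max_eq_left hx0]
        linear_combination h3 - h4
      have h5 : |Real.exp (-x) * (interpolation ν s s₀ s₁ (Real.exp x) - S - Real.exp x)| ≤
          C₁ * Real.exp (-(1 / 4) * x) := by
        rw [abs_mul, abs_of_pos (Real.exp_pos _)]
        refine (mul_le_mul_of_nonneg_left (herr _ ht) (Real.exp_pos _).le).trans (le_of_eq ?_)
        rw [← Real.exp_mul, mul_left_comm, ← Real.exp_add]
        congr 2; ring
      have h6 : |(entropyConst ν)⁻¹ * (x - J - entropyConst ν)| ≤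
          (entropyConst ν)⁻¹ * (4 * E * Real.exp (-(1 / 4) * x)) := by
        rw [abs_mul, abs_of_pos (inv_pos.2 hμ)]
        exact mul_le_mul_of_nonneg_left (h.abs_integral_max_sub_le x) (inv_pos.2 hμ).le
      rw [h1, h2]
      refine (abs_sub _ _).trans ((add_le_add h5 h6).trans (le_of_eq ?_))
      ring
  exact ⟨C, _, hC⟩

/-- Either the support of the step law generates a dense group, or the span is positive and belongs
to the group that it generates. -/
theorem dense_or_span_mem (h : Admissible ν s s₀ s₁) :
    Dense (AddSubgroup.closure (stepLaw ν).support : Set ℝ) ∨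
      0 < span ν ∧ span ν ∈ AddSubgroup.closure (stepLaw ν).support := by
  refine (AddSubgroup.dense_or_cyclic _).imp_right fun ⟨a, ha⟩ => ?_
  rw [← AddSubgroup.zmultiples_eq_closure] at ha
  obtain ⟨y₀, hy₀pos, hy₀supp⟩ := Measure.nonempty_inter_support_of_pos h.stepLaw_Ioi_pos
  have ha0 : a ≠ 0 := by
    rintro rfl
    have : y₀ ∈ AddSubgroup.closure (stepLaw ν).support := AddSubgroup.subset_closure hy₀supp
    rw [ha, AddSubgroup.zmultiples_zero_eq_bot, AddSubgroup.mem_bot] at this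
    exact (ne_of_gt hy₀pos) this
  have habs : |a| ∈ AddSubgroup.closure (stepLaw ν).support := by
    rw [ha]
    rcases abs_choice a with h1 | h1 <;> rw [h1]
    · exact AddSubgroup.mem_zmultiples a
    · exact neg_mem (AddSubgroup.mem_zmultiples a)
  have hspan : span ν = |a| := by
    refine IsGreatest.csSup_eq ⟨⟨abs_nonneg a, ?_⟩, fun a' ⟨ha'0, ha'⟩ => ?_⟩
    · rw [logInMultiples_iff]
      filter_upwards [Measure.support_mem_ae (μ := stepLaw ν)] with y hy
      have h1 : y ∈ AddSubgroup.zmultiples a := ha ▸ AddSubgroup.subset_closure hy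
      rcases abs_choice a with h2 | h2 <;> rw [h2]
      · exact h1
      · rwa [AddSubgroup.zmultiples_neg]
    · rw [logInMultiples_iff] at ha'
      have hcl : IsClosed (AddSubgroup.zmultiples a' : Set ℝ) :=
        AddSubgroup.isClosed_of_discrete
      have h1 : (stepLaw ν).support ⊆ AddSubgroup.zmultiples a' :=
        Measure.support_subset_of_isClosed hcl ha'
      have h2 : |a| ∈ AddSubgroup.zmultiples a' := (AddSubgroup.closure_le _).2 h1 habs
      obtain ⟨k, hk⟩ := AddSubgroup.mem_zmultiples_iff.1 h2
      rw [zsmul_eq_mul] at hk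
      have hk0 : 0 < k := by
        by_contra! hk0
        have : (k : ℝ) ≤ 0 := by exact_mod_cast hk0
        nlinarith [abs_pos.2 ha0]
      have hk1 : (1 : ℝ) ≤ k := by exact_mod_cast hk0
      nlinarith
  exact ⟨hspan ▸ abs_pos.2 ha0, hspan ▸ habs⟩

end Admissible

theorem span_eq_zero_of_not_isLattice {b : ℕ} {ν : Measure (Fin b → ℝ)} (h : ¬ IsLattice ν) :
    span ν = 0 := by
  have : {a : ℝ | 0 ≤ a ∧ LogInMultiples ν a} = ∅ :=
    eq_empty_of_forall_notMem fun a ha => h ⟨a, ha.2⟩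
  rw [span, this, Real.sSup_empty]

end SplitTree

theorem theorem3p1 {b : ℕ} (s s₀ s₁ : ℕ)
    (hparam : s₀ + b * s₁ ≤ s + 1)
    (hstore : 0 < s ∨ 0 < s₀)
    (ν : Measure (Fin b → ℝ)) [IsProbabilityMeasure ν]
    (hsimplex : ∀ᵐ v ∂ν, (∀ i, 0 ≤ v i) ∧ ∑ i, v i = 1)
    (hsplit : ν {v | ∃ i, v i = 1} < 1) :
    (∀ n : ℕ, SplitTree.expectedPathLength ν s s₀ s₁ n ≠ ∞) ∧
    (¬ SplitTree.IsLattice ν → SplitTree.span ν = 0) ∧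
    ∃ ϖ : ℝ → ℝ,
      Continuous ϖ ∧
      Function.Periodic ϖ (SplitTree.span ν) ∧
      (SplitTree.span ν = 0 → ∃ c : ℝ, ∀ x, ϖ x = c) ∧
      (fun n : ℕ => (SplitTree.expectedPathLength ν s s₀ s₁ n).toReal
          - ((SplitTree.entropyConst ν)⁻¹ * n * Real.log n + n * ϖ (Real.log n)))
        =o[atTop] fun n : ℕ => (n : ℝ) := by
  have h : SplitTree.Admissible ν s s₀ s₁ := ⟨hparam, hstore, hsimplex, hsplit⟩
  refine ⟨h.expectedPathLength_ne_top, SplitTree.span_eq_zero_of_not_isLattice, ?_⟩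
  have hP := h.isProbabilityMeasure_stepLaw
  obtain ⟨C, r, hs⟩ := h.exists_isRenewalSolution_centredPathLength
  obtain ⟨L, hLc, hLper, hL⟩ := hs.exists_periodic_limit h.stepLaw_nonneg h.stepLaw_Ioi_pos
    (by norm_num) (h.integrable_exp_stepLaw (by norm_num))
  have hconst : Dense (AddSubgroup.closure (SplitTree.stepLaw ν).support : Set ℝ) →
      ∀ x, L x = L 0 := fun hd x => by
    have := hLper x (hd x) 0
    rwa [zero_add] at this
  refine ⟨L, hLc, ?_, ?_, ?_⟩
  · rcases h.dense_or_span_mem with hd | ⟨-, hmem⟩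
    · intro x
      rw [hconst hd, hconst hd x]
    · exact hLper _ (AddSubgroup.le_topologicalClosure _ hmem)
  · intro h0
    rcases h.dense_or_span_mem with hd | ⟨hpos, -⟩
    · exact ⟨L 0, hconst hd⟩
    · exact absurd h0 hpos.ne'
  · have h1 := hL.comp (Real.tendsto_log_atTop.comp tendsto_natCast_atTop_atTop)
    refine (isLittleO_iff_tendsto' ?_).2 (h1.congr' ?_)
    · filter_upwards [eventually_gt_atTop 0] with n hn h0
      exact absurd h0 (by positivity)
    · filter_upwards [eventually_gt_atTop 0] with n hn
      have hn0 : (0 : ℝ) < n := Nat.cast_pos.2 hn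
      have hlog : 0 ≤ Real.log n := Real.log_nonneg (Nat.one_le_cast.2 hn)
      simp only [Function.comp, SplitTree.centredPathLength]
      rw [Real.exp_neg, Real.exp_log hn0, max_eq_left hlog, h.interpolation_natCast,
        SplitTree.meanPathLength]
      field_simp
      ring
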